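/- Let $d\ge 1$ and let $\Omega\subset\mathbb{R}^d$ be a bounded open set with $C^1$ boundary $\partial\Omega$, outer unit normal $\mathrm n$, and surface measure $dS$ on $\partial\Omega$; $|\Omega|$ and $|\partial\Omega|$ denote the Lebesgue measure of $\Omega$ and the surface measure of $\partial\Omega$. There is a constant $C>0$, depending only on $d$ and $\Omega$, such that the following holds. Let $\sigma,\lambda,\varepsilon>0$ and $\delta\in\mathbb{R}$, let $f\in L^2(\Omega)$, $g\in L^2(\partial\Omega)$ and $c\in L^2(\Omega)$ with $c\ge\sigma$ a.e. in $\Omega$, and suppose that the Neumann problem $$-\Delta u+cu=f\ \text{ in }\Omega,\qquad \frac{\partial u}{\partial \mathrm n}=g\ \text{ on }\partial\Omega$$ has a unique solution $u_*\in C^1(\overline\Omega)$ (the equation being understood in the sense of distributions, the boundary condition a.e. on $\partial\Omega$). For positive continuous functions $\phi'$ on $\Omega$ and $\phi''$ on $\partial\Omega$ and for $u\in C^2(\overline\Omega)$ put $$R_{\phi',\phi''}(u)=\int_\Omega\phi'\,|-\Delta u+cu-f|^2\,dx+\lambda\int_{\partial\Omega}\phi''\,\Big|\frac{\partial u}{\partial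 \mathrm n}-g\Big|^2\,dS,\qquad J(u)=R_{1,1}(u).$$ Let $\mathcal N\subset C^2(\overline\Omega)$ be an admissible set. Let $\mathcal S'$ be a set of positive continuous functions on $\Omega$ containing the constant $1$, let $\mathcal S''$ be a set of positive continuous functions on $\partial\Omega$ containing the constant $1$, and put $$J_{\mathcal S',\mathcal S''}(u)=\sup_{\phi'\in\mathcal S',\,\phi''\in\mathcal S''}\left\{R_{\phi',\phi''}(u)-\varepsilon^{-1}\left[\Big(\frac1{|\Omega|}\int_\Omega\phi'\,dx-1\Big)^2+\Big(\frac1{|\partial\Omega|}\int_{\partial\Omega}\phi''\,dS-1\Big)^2\right]\right\}\in(-\infty,\infty],$$ where the expression in braces is read as $-\infty$ if $\phi'$ or $\phi''$ is not integrable. If $u_b,u_s\in\mathcal N$ satisfy $J(u_b)<\delta$ (the basic least-squares model) and $J_{\mathcal S',\mathcal S''}(u_s)<\delta$ (the SelectNet model), then $$\|u_b-u_s\|_{H^1(\Omega)}\le C\,\max(1,\sigma^{-1})\,\max(1,\lambda^{-1/2})\,\delta^{1/2}.$$ -/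

import Mathlib

open MeasureTheory Set Filter Topology
open scoped ENNReal ContDiff Laplacian Gradient

noncomputable section

/-- `ℝ^d` with the Euclidean norm. -/
abbrev Euc (d : ℕ) : Type := EuclideanSpace ℝ (Fin d)

/-- The boundary of `Ω` is `C¹`: near each boundary point, after a choice of orthonormal axes
(the last axis being the unit vector `e`), `Ω` is the strict epigraph of a `C¹` function `γ` of the
variables orthogonal to `e`. -/
def HasC1Boundary {d : ℕ} (Ω : Set (Euc d)) : Prop :=
  ∀ x₀ ∈ frontier Ω, ∃ (r : ℝ) (e : Euc d) (γ : (Submodule.span ℝ {e})ᗮ → ℝ),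
    0 < r ∧ ‖e‖ = 1 ∧ ContDiff ℝ 1 γ ∧
    ∀ x ∈ Metric.ball x₀ r,
      (x ∈ Ω ↔ γ ((Submodule.span ℝ {e})ᗮ.orthogonalProjectionOnto x) < inner ℝ e x)

/-- The surface measure on `∂Ω`: the `(d-1)`-dimensional Hausdorff measure, normalised to agree
with Lebesgue measure on `(d-1)`-dimensional Euclidean space, restricted to `∂Ω`. -/
def surfaceMeasure {d : ℕ} (Ω : Set (Euc d)) : Measure (Euc d) :=
  (μHE[d - 1] : Measure (Euc d)).restrict (frontier Ω)

/-- `n` is an outer unit normal of `Ω` at `x`: rays from `x` in directions `v` with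
`⟨n, v⟩ < 0` start inside `Ω`, those with `⟨n, v⟩ > 0` start outside `Ω`.
At a boundary point of a set with `C¹` boundary there is exactly one such `n`. -/
def IsOuterUnitNormal {d : ℕ} (Ω : Set (Euc d)) (x n : Euc d) : Prop :=
  ‖n‖ = 1 ∧ ∀ v : Euc d,
    (inner ℝ n v < 0 → ∀ᶠ t in 𝓝[>] (0 : ℝ), x + t • v ∈ Ω) ∧
    (0 < inner ℝ n v → ∀ᶠ t in 𝓝[>] (0 : ℝ), x + t • v ∉ Ω)

open Classical in
/-- The outer unit normal of `Ω` at `x` (and `0` where there is none). -/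
def outerNormal {d : ℕ} (Ω : Set (Euc d)) (x : Euc d) : Euc d :=
  if h : ∃ n, IsOuterUnitNormal Ω x n then h.choose else 0

/-- The space `C^k(Ω̄)`. Values of `u` off `Ω̄` are irrelevant. -/
def CkClosure {d : ℕ} (k : ℕ) (Ω : Set (Euc d)) : Set (Euc d → ℝ) :=
  {u | ContDiffOn ℝ k u (closure Ω)}

/-- The outward normal derivative `∂u/∂n` at a boundary point `x`, for `u ∈ C¹(Ω̄)`. -/
def normalDeriv {d : ℕ} (Ω : Set (Euc d)) (u : Euc d → ℝ) (x : Euc d) : ℝ :=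
  fderivWithin ℝ u (closure Ω) x (outerNormal Ω x)

/-- `u ∈ C¹(Ω̄)` solves `-Δu + c u = f` in `Ω`, in the sense of distributions, and
`∂u/∂n = g` almost everywhere on `∂Ω`. -/
def IsNeumannSolution {d : ℕ} (Ω : Set (Euc d)) (c f g u : Euc d → ℝ) : Prop :=
  u ∈ CkClosure 1 Ω ∧
  (∀ φ : Euc d → ℝ, ContDiff ℝ ∞ φ → HasCompactSupport φ → tsupport φ ⊆ Ω →
    ∫ x in Ω, (-(u x * Δ φ x) + c x * u x * φ x) = ∫ x in Ω, f x * φ x) ∧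
  ∀ᵐ x ∂(surfaceMeasure Ω), normalDeriv Ω u x = g x

/-- The Neumann problem has exactly one solution in `C¹(Ω̄)` (as a function on `Ω̄`). -/
def HasUniqueNeumannSolution {d : ℕ} (Ω : Set (Euc d)) (c f g : Euc d → ℝ) : Prop :=
  ∃ u, IsNeumannSolution Ω c f g u ∧
    ∀ v, IsNeumannSolution Ω c f g v → EqOn v u (closure Ω)

/-- `∫_Ω φ' |-Δu + cu - f|² dx + λ ∫_{∂Ω} φ'' |∂u/∂n - g|² dS`, for nonnegative weights
`φ'` on `Ω` and `φ''` on `∂Ω`, with values in `[0, ∞]`. -/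
def weightedResidual {d : ℕ} (Ω : Set (Euc d)) (c f g : Euc d → ℝ) (lam : ℝ)
    (φ' φ'' u : Euc d → ℝ) : ℝ≥0∞ :=
  (∫⁻ x in Ω, ENNReal.ofReal (φ' x * |-(Δ u x) + c x * u x - f x| ^ 2)) +
    ENNReal.ofReal lam *
      ∫⁻ x, ENNReal.ofReal (φ'' x * |normalDeriv Ω u x - g x| ^ 2) ∂(surfaceMeasure Ω)

/-- The basic least-squares loss `J(u)`. -/
def basicLoss {d : ℕ} (Ω : Set (Euc d)) (c f g : Euc d → ℝ) (lam : ℝ) (u : Euc d → ℝ) : ℝ≥0∞ :=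
  weightedResidual Ω c f g lam (fun _ => 1) (fun _ => 1) u

/-- The normalisation penalty
`(|Ω|⁻¹ ∫_Ω φ' dx - 1)² + (|∂Ω|⁻¹ ∫_{∂Ω} φ'' dS - 1)²` of positive weights. -/
def selectPenalty {d : ℕ} (Ω : Set (Euc d)) (φ' φ'' : Euc d → ℝ) : EReal :=
  (((∫⁻ x in Ω, ENNReal.ofReal (φ' x)) / volume Ω : ℝ≥0∞) - 1 : EReal) ^ 2 +
    (((∫⁻ x, ENNReal.ofReal (φ'' x) ∂(surfaceMeasure Ω)) /
      surfaceMeasure Ω univ : ℝ≥0∞) - 1 : EReal) ^ 2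

/-- The SelectNet loss `J_{S',S''}(u)`: the supremum over `φ' ∈ S'`, `φ'' ∈ S''` of the weighted
residual minus `ε⁻¹` times the penalty. A weight that is not integrable has infinite penalty, and
then the expression is `-∞` (this includes `∞ - ∞`), so such weights do not count. -/
def selectLoss {d : ℕ} (Ω : Set (Euc d)) (c f g : Euc d → ℝ) (lam ε : ℝ)
    (S' S'' : Set (Euc d → ℝ)) (u : Euc d → ℝ) : EReal :=
  ⨆ φ' ∈ S', ⨆ φ'' ∈ S'',
    ((weightedResidual Ω c f g lam φ' φ'' u : ℝ≥0∞) : EReal) -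
      ((ε⁻¹ : ℝ) : EReal) * selectPenalty Ω φ' φ''

/-- `S` is a set of positive continuous functions on `A` (values off `A` are irrelevant) that
contains the constant function `1`. -/
def IsWeightClass {d : ℕ} (A : Set (Euc d)) (S : Set (Euc d → ℝ)) : Prop :=
  (∀ φ ∈ S, ContinuousOn φ A ∧ ∀ x ∈ A, 0 < φ x) ∧ ∃ φ ∈ S, ∀ x ∈ A, φ x = 1

/-- The `H¹(Ω)` norm `(∫_Ω |w|² + |∇w|² dx)^{1/2}` of a function `w` that is `C¹` in `Ω`,
with values in `[0, ∞]`. -/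
def h1Norm {d : ℕ} (Ω : Set (Euc d)) (w : Euc d → ℝ) : ℝ≥0∞ :=
  (∫⁻ x in Ω, ENNReal.ofReal (|w x| ^ 2 + ‖∇ w x‖ ^ 2)) ^ (1 / 2 : ℝ)

end

/-!
Let `w = u_b - u_s`. Testing `-Δw + c w` against `w` and integrating by parts bounds
`∫ |∇w|² + c w²` by `∫ (-Δw + c w) w` plus the boundary integral of `w ∂w/∂n`. Since `c ≥ σ`, the
left side controls the `H¹` norm, and the trace inequality allows the boundary values of `w` to be
absorbed as well (`HasC1Boundary.exists_energy_le`). Both residuals of `w` are differences of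
residuals of `u_b` and `u_s`, in which `f` and `g` cancel. The residuals of `u_b` are small by
hypothesis, those of `u_s` because the constant weights `1` have zero penalty
(`basicLoss_le_selectLoss`). The latter needs
`0 < |∂Ω| < ∞`, which is proved here for the Hausdorff measure.

The two facts about the domain, Green's identity (as an inequality up to a constant,
`HasC1Boundary.exists_green_le`) and the trace inequality (`HasC1Boundary.exists_trace_le`), are
derived from a divergence theorem above the graph of a `C¹` function `γ`
(`setIntegral_fderiv_epigraph`): the shear straightening the graph preserves volume, horizontal
derivatives then integrate to zero on each translated graph, and vertical ones are handled by the
fundamental theorem of calculus. A partition of unity reduces `Ω` to such charts. The boundary terms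
are integrals over the graph with respect to Lebesgue measure of the base hyperplane. The area
formula is not needed: as the constant may depend on the domain, it is enough that this measure and
the surface measure bound each other up to a factor in each chart, because the projection
(`IsGraphChart.graphMeasure_restrict_le`) and the graph map
(`IsGraphChart.exists_surfaceMeasure_restrict_le`) are Lipschitz.
-/

/-! ### Graph coordinates -/

/-- The hyperplane through the origin orthogonal to `e`. -/
noncomputable abbrev perp {d : ℕ} (e : Euc d) : Submodule ℝ (Euc d) := (Submodule.span ℝ {e})ᗮ

/-- Orthogonal projection onto the hyperplane orthogonal to `e`. -/
noncomputable abbrev perpProj {d : ℕ} (e : Euc d) : Euc d →L[ℝ] perp e :=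
  (perp e).orthogonalProjectionOnto

/-- The signed height of `x` above the graph of `γ`, measured in direction `e`. -/
noncomputable def graphHeight {d : ℕ} (e : Euc d) (γ : perp e → ℝ) (x : Euc d) : ℝ :=
  inner ℝ e x - γ (perpProj e x)

/-- The point at height `p.2` above the graph of `γ`, over the base point `p.1`. -/
noncomputable def graphPoint {d : ℕ} (e : Euc d) (γ : perp e → ℝ) (p : perp e × ℝ) : Euc d :=
  (p.1 : Euc d) + (γ p.1 + p.2) • e

section Projection

variable {d : ℕ} {e : Euc d}

lemma inner_perp (y : perp e) : inner ℝ e (y : Euc d) = 0 :=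
  Submodule.mem_orthogonal_singleton_iff_inner_right.1 y.2

lemma perpProj_coe_add_smul (y : perp e) (t : ℝ) :
    perpProj e ((y : Euc d) + t • e) = y := by
  rw [map_add, map_smul, Submodule.orthogonalProjectionOnto_mem_subspace_eq_self,
    Submodule.orthogonalProjectionOnto_orthogonalComplement_singleton_eq_zero, smul_zero, add_zero]

lemma inner_coe_add_smul (he : ‖e‖ = 1) (y : perp e) (t : ℝ) :
    inner ℝ e ((y : Euc d) + t • e) = t := by
  rw [inner_add_right, inner_perp, inner_smul_right, real_inner_self_eq_norm_sq, he]
  norm_num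

lemma perpProj_add_inner_smul (he : ‖e‖ = 1) (x : Euc d) :
    ((perpProj e x : perp e) : Euc d) + (inner ℝ e x : ℝ) • e = x := by
  have h := (Submodule.span ℝ {e}).starProjection_add_starProjection_orthogonal x
  simp only [Submodule.starProjection_unit_singleton ℝ he] at h
  rw [add_comm] at h
  exact h

lemma perpProj_self : perpProj e e = 0 :=
  Submodule.orthogonalProjectionOnto_orthogonalComplement_singleton_eq_zero e

lemma finrank_perp (he : ‖e‖ = 1) : Module.finrank ℝ (perp e) = d - 1 := by
  have h := (Submodule.span ℝ {e}).finrank_add_finrank_orthogonal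
  have he0 : e ≠ 0 := by rintro rfl; simp at he
  rw [finrank_span_singleton he0, finrank_euclideanSpace_fin] at h
  have : Module.finrank ℝ (perp e) = Module.finrank ℝ (Submodule.span ℝ {e})ᗮ := rfl
  omega

/-- `(y, t) ↦ y + t e` preserves volume. -/
lemma measurePreserving_coe_add_smul (he : ‖e‖ = 1) :
    MeasurePreserving (fun p : perp e × ℝ => (p.1 : Euc d) + p.2 • e)
      (volume.prod volume) volume := by
  let s : Submodule ℝ (Euc d) := Submodule.span ℝ {e}
  have h1 : MeasurePreserving ((s.measurableEquivProd (0 : Euc d)).symm) (volume.prod volume)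
      volume := by
    have := (s.measurePreserving_measurableEquivProd (0 : Euc d)).symm
    rwa [InnerProductSpace.euclideanHausdorffMeasure_eq_volume] at this
  have h2 : MeasurePreserving (LinearIsometryEquiv.toSpanUnitSingleton (𝕜 := ℝ) e he)
      volume volume :=
    (LinearIsometryEquiv.toSpanUnitSingleton (𝕜 := ℝ) e he).measurePreserving
  have h3 : MeasurePreserving (Prod.swap : perp e × ℝ → ℝ × perp e) (volume.prod volume)
      (volume.prod volume) := Measure.measurePreserving_swap
  have h4 := h1.comp ((h2.prod (MeasurePreserving.id (volume : Measure (perp e)))).comp h3)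
  convert h4 using 1
  ext p
  simp [LinearIsometryEquiv.toSpanUnitSingleton, s, add_comm]

end Projection

section GraphCoordinates

variable {d : ℕ} {e : Euc d} {γ : perp e → ℝ}

lemma graphHeight_graphPoint (he : ‖e‖ = 1) (p : perp e × ℝ) :
    graphHeight e γ (graphPoint e γ p) = p.2 := by
  rw [graphHeight, graphPoint, perpProj_coe_add_smul, inner_coe_add_smul he]; ring

lemma perpProj_graphPoint (p : perp e × ℝ) : perpProj e (graphPoint e γ p) = p.1 :=
  perpProj_coe_add_smul _ _

lemma graphPoint_perpProj_graphHeight (he : ‖e‖ = 1) (x : Euc d) :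
    graphPoint e γ (perpProj e x, graphHeight e γ x) = x := by
  rw [graphPoint, graphHeight]
  simpa using perpProj_add_inner_smul he x

lemma continuous_graphPoint (hγ : Continuous γ) : Continuous (graphPoint e γ) := by
  unfold graphPoint; fun_prop

lemma continuous_graphHeight (hγ : Continuous γ) : Continuous (graphHeight e γ) := by
  unfold graphHeight; fun_prop

/-- Graph coordinates as a homeomorphism of the whole space. -/
noncomputable def graphHomeomorph (he : ‖e‖ = 1) (hγ : Continuous γ) : perp e × ℝ ≃ₜ Euc d where
  toFun := graphPoint e γ
  invFun x := (perpProj e x, graphHeight e γ x)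
  left_inv p := Prod.ext (perpProj_graphPoint p) (graphHeight_graphPoint he p)
  right_inv x := graphPoint_perpProj_graphHeight he x
  continuous_toFun := continuous_graphPoint hγ
  continuous_invFun := (perpProj e).continuous.prodMk (continuous_graphHeight hγ)

/-- Graph coordinates preserve volume, since they are a shear. -/
lemma measurePreserving_graphPoint (he : ‖e‖ = 1) (hγ : Continuous γ) :
    MeasurePreserving (graphPoint e γ) (volume.prod volume) volume := by
  have h := MeasurePreserving.skew_product (μa := (volume : Measure (perp e)))
    (μb := (volume : Measure (perp e))) (μc := (volume : Measure ℝ)) (μd := (volume : Measure ℝ))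
    (f := id) (MeasurePreserving.id _) (g := fun y t => γ y + t)
    (by unfold Function.uncurry; fun_prop)
    (Eventually.of_forall fun y => (measurePreserving_add_left volume (γ y)).map_eq)
  exact (measurePreserving_coe_add_smul he).comp h

lemma contDiff_graphPoint (hγ : ContDiff ℝ 1 γ) : ContDiff ℝ 1 (graphPoint e γ) := by
  have h1 : ContDiff ℝ 1 fun p : perp e × ℝ => ((p.1 : perp e) : Euc d) :=
    (perp e).subtypeL.contDiff.comp contDiff_fst
  exact h1.add (((hγ.comp contDiff_fst).add contDiff_snd).smul contDiff_const)

/-- The derivative at `y` of `γ (P x) - ⟨e, x⟩`, where `P` is the projection along `e`. It is a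
conormal of the graph of `γ`, pointing downwards. -/
noncomputable def conormal (e : Euc d) (γ : perp e → ℝ) (y : perp e) : Euc d →L[ℝ] ℝ :=
  (fderiv ℝ γ y).comp (perpProj e) - innerSL ℝ e

lemma conormal_apply (y : perp e) (v : Euc d) :
    conormal e γ y v = fderiv ℝ γ y (perpProj e v) - inner ℝ e v := rfl

lemma conormal_self (he : ‖e‖ = 1) (y : perp e) : conormal e γ y e = -1 := by
  rw [conormal_apply, perpProj_self, map_zero, real_inner_self_eq_norm_sq, he]; norm_num

lemma hasFDerivAt_graphHeight (hγ : ContDiff ℝ 1 γ) (x : Euc d) :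
    HasFDerivAt (graphHeight e γ) (-conormal e γ (perpProj e x)) x := by
  have h1 : HasFDerivAt (fun x : Euc d => (inner ℝ e x : ℝ)) (innerSL ℝ e) x :=
    (innerSL ℝ e).hasFDerivAt
  have h2 : HasFDerivAt γ (fderiv ℝ γ (perpProj e x)) (perpProj e x) :=
    (hγ.differentiable one_ne_zero _).hasFDerivAt
  rw [conormal, neg_sub]
  exact h1.sub (h2.comp x (perpProj e).hasFDerivAt)

lemma continuous_conormal (hγ : ContDiff ℝ 1 γ) : Continuous (conormal e γ) := by
  have := hγ.continuous_fderiv one_ne_zero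
  unfold conormal
  fun_prop

/-- The downward normal vector of the graph of `γ` over `y`, scaled so that its component along `e`
is `-1`. -/
noncomputable def graphNormal (e : Euc d) (γ : perp e → ℝ) (y : perp e) : Euc d :=
  (InnerProductSpace.toDual ℝ (Euc d)).symm (conormal e γ y)

lemma inner_graphNormal (y : perp e) (v : Euc d) :
    inner ℝ (graphNormal e γ y) v = conormal e γ y v := by
  rw [graphNormal, InnerProductSpace.toDual_symm_apply]

lemma continuous_graphNormal (hγ : ContDiff ℝ 1 γ) : Continuous (graphNormal e γ) :=
  (InnerProductSpace.toDual ℝ (Euc d)).symm.continuous.comp (continuous_conormal hγ)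

lemma graphNormal_ne_zero (he : ‖e‖ = 1) (y : perp e) : graphNormal e γ y ≠ 0 := by
  intro h
  have := inner_graphNormal (γ := γ) y e
  rw [h, conormal_self he, inner_zero_left] at this
  norm_num at this

end GraphCoordinates

/-! ### Boundary charts and the outer normal -/

/-- In the ball of radius `r` around `x₀`, the set `Ω` is the strict epigraph of the `C¹` function
`γ`, the vertical direction being `e`. -/
structure IsGraphChart {d : ℕ} (Ω : Set (Euc d)) (x₀ : Euc d) (r : ℝ) (e : Euc d)
    (γ : perp e → ℝ) : Prop where
  norm_eq_one : ‖e‖ = 1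
  contDiff : ContDiff ℝ 1 γ
  mem_iff : ∀ x ∈ Metric.ball x₀ r, (x ∈ Ω ↔ 0 < graphHeight e γ x)

lemma HasC1Boundary.exists_isGraphChart {d : ℕ} {Ω : Set (Euc d)} (hΩ : HasC1Boundary Ω)
    {x₀ : Euc d} (hx₀ : x₀ ∈ frontier Ω) :
    ∃ (r : ℝ) (e : Euc d) (γ : perp e → ℝ), 0 < r ∧ IsGraphChart Ω x₀ r e γ := by
  obtain ⟨r, e, γ, hr, he, hγ, h⟩ := hΩ x₀ hx₀
  exact ⟨r, e, γ, hr, he, hγ, fun x hx => by rw [h x hx, graphHeight, sub_pos]⟩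

namespace IsGraphChart

variable {d : ℕ} {Ω : Set (Euc d)} {x₀ : Euc d} {r : ℝ} {e : Euc d} {γ : perp e → ℝ}

lemma hasDerivAt_graphHeight_line (h : IsGraphChart Ω x₀ r e γ) (x v : Euc d) :
    HasDerivAt (fun t : ℝ => graphHeight e γ (x + t • v)) (-conormal e γ (perpProj e x) v) 0 := by
  have h1 : HasDerivAt (fun t : ℝ => x + t • v) v 0 := by
    simpa using ((hasDerivAt_id (0 : ℝ)).smul_const v).const_add x
  have h2 := hasFDerivAt_graphHeight h.contDiff (x + (0 : ℝ) • v)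
  have h3 := h2.comp_hasDerivAt (0 : ℝ) h1
  rw [zero_smul, add_zero] at h3
  exact h3

lemma eventually_mem_ball {x : Euc d} (hx : x ∈ Metric.ball x₀ r) (v : Euc d) :
    ∀ᶠ t in 𝓝[>] (0 : ℝ), x + t • v ∈ Metric.ball x₀ r := by
  have hc : Continuous fun t : ℝ => x + t • v := by fun_prop
  have : Tendsto (fun t : ℝ => x + t • v) (𝓝 0) (𝓝 x) := by
    simpa using hc.tendsto 0
  exact (this.mono_left nhdsWithin_le_nhds) (Metric.isOpen_ball.mem_nhds hx)

/-- From a point of the graph, directions pointing above the tangent plane lead into `Ω`. -/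
lemma eventually_mem (h : IsGraphChart Ω x₀ r e γ) {x : Euc d} (hx : x ∈ Metric.ball x₀ r)
    (hx0 : graphHeight e γ x = 0) {v : Euc d} (hv : conormal e γ (perpProj e x) v < 0) :
    ∀ᶠ t in 𝓝[>] (0 : ℝ), x + t • v ∈ Ω := by
  have h1 := (h.hasDerivAt_graphHeight_line x v).tendsto_slope_zero_right
  filter_upwards [h1.eventually (lt_mem_nhds (neg_pos.2 hv)), eventually_mem_ball hx v,
    self_mem_nhdsWithin] with t ht hb (htp : 0 < t)
  rw [h.mem_iff _ hb]
  simp only [zero_add, zero_smul, add_zero, hx0, sub_zero, smul_eq_mul] at ht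
  exact (pos_iff_pos_of_mul_pos ht).1 (inv_pos.2 htp)

lemma eventually_notMem (h : IsGraphChart Ω x₀ r e γ) {x : Euc d} (hx : x ∈ Metric.ball x₀ r)
    (hx0 : graphHeight e γ x = 0) {v : Euc d} (hv : 0 < conormal e γ (perpProj e x) v) :
    ∀ᶠ t in 𝓝[>] (0 : ℝ), x + t • v ∉ Ω := by
  have h1 := (h.hasDerivAt_graphHeight_line x v).tendsto_slope_zero_right
  filter_upwards [h1.eventually (gt_mem_nhds (neg_neg_iff_pos.2 hv)), eventually_mem_ball hx v,
    self_mem_nhdsWithin] with t ht hb (htp : 0 < t)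
  rw [h.mem_iff _ hb, not_lt]
  simp only [zero_add, zero_smul, add_zero, hx0, sub_zero, smul_eq_mul] at ht
  by_contra! hc
  have := mul_pos (inv_pos.2 htp) hc
  linarith

lemma mem_closure_iff (h : IsGraphChart Ω x₀ r e γ) {x : Euc d} (hx : x ∈ Metric.ball x₀ r) :
    x ∈ closure Ω ↔ 0 ≤ graphHeight e γ x := by
  constructor
  · intro hxc
    by_contra! hneg
    have hnhds : {z | graphHeight e γ z < 0} ∩ Metric.ball x₀ r ∈ 𝓝 x :=
      inter_mem ((continuous_graphHeight h.contDiff.continuous).continuousAt.eventually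
        (gt_mem_nhds hneg)) (Metric.isOpen_ball.mem_nhds hx)
    obtain ⟨z, ⟨hz1, hz2⟩, hzΩ⟩ := mem_closure_iff_nhds.1 hxc _ hnhds
    exact absurd ((h.mem_iff z hz2).1 hzΩ) (not_lt.2 (le_of_lt hz1))
  · intro hx0
    rcases hx0.lt_or_eq with hpos | hzero
    · exact subset_closure ((h.mem_iff x hx).2 hpos)
    · have hev := h.eventually_mem hx hzero.symm (v := e)
        (by rw [conormal_self h.norm_eq_one]; norm_num)
      refine mem_closure_of_tendsto (f := fun t : ℝ => x + t • e) (b := 𝓝[>] (0 : ℝ)) ?_ hev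
      have hc : Continuous fun t : ℝ => x + t • e := by fun_prop
      simpa using (hc.tendsto 0).mono_left (nhdsWithin_le_nhds (s := Ioi (0 : ℝ)))

lemma mem_frontier_iff (h : IsGraphChart Ω x₀ r e γ) (hΩ : IsOpen Ω) {x : Euc d}
    (hx : x ∈ Metric.ball x₀ r) : x ∈ frontier Ω ↔ graphHeight e γ x = 0 := by
  rw [hΩ.frontier_eq, Set.mem_sdiff, h.mem_closure_iff hx, h.mem_iff x hx, not_lt]
  exact ⟨fun h => le_antisymm h.2 h.1, fun h => ⟨h.ge, h.le⟩⟩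

lemma isOuterUnitNormal (h : IsGraphChart Ω x₀ r e γ) {x : Euc d} (hx : x ∈ Metric.ball x₀ r)
    (hx0 : graphHeight e γ x = 0) :
    IsOuterUnitNormal Ω x ((‖graphNormal e γ (perpProj e x)‖)⁻¹ •
      graphNormal e γ (perpProj e x)) := by
  have hm := graphNormal_ne_zero (γ := γ) h.norm_eq_one (perpProj e x)
  have hpos : 0 < (‖graphNormal e γ (perpProj e x)‖)⁻¹ := inv_pos.2 (norm_pos_iff.2 hm)
  refine ⟨?_, fun v => ⟨fun hv => ?_, fun hv => ?_⟩⟩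
  · rw [norm_smul, norm_inv, norm_norm, inv_mul_cancel₀ (norm_ne_zero_iff.2 hm)]
  · rw [real_inner_smul_left, inner_graphNormal] at hv
    exact h.eventually_mem hx hx0 (by nlinarith)
  · rw [real_inner_smul_left, inner_graphNormal] at hv
    exact h.eventually_notMem hx hx0 ((pos_iff_pos_of_mul_pos hv).1 hpos)

end IsGraphChart

/-- Two distinct unit vectors are separated by some direction, so the outer normal is unique. -/
lemma IsOuterUnitNormal.eq {d : ℕ} {Ω : Set (Euc d)} {x n m : Euc d}
    (hn : IsOuterUnitNormal Ω x n) (hm : IsOuterUnitNormal Ω x m) : n = m := by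
  by_contra hne
  have hlt : (inner ℝ n m : ℝ) < 1 := (inner_lt_one_iff_real_of_norm_eq_one hn.1 hm.1).2 hne
  have hnn : (inner ℝ n n : ℝ) = 1 := by rw [real_inner_self_eq_norm_sq, hn.1]; norm_num
  have hmm : (inner ℝ m m : ℝ) = 1 := by rw [real_inner_self_eq_norm_sq, hm.1]; norm_num
  have h1 := (hn.2 (m - n)).1 (by rw [inner_sub_right]; linarith)
  have h2 := (hm.2 (m - n)).2 (by rw [inner_sub_right, real_inner_comm n m]; linarith)
  obtain ⟨t, ht1, ht2⟩ := (h1.and h2).exists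
  exact ht2 ht1

lemma IsGraphChart.outerNormal_eq {d : ℕ} {Ω : Set (Euc d)} {x₀ : Euc d} {r : ℝ} {e : Euc d}
    {γ : perp e → ℝ} (h : IsGraphChart Ω x₀ r e γ) {x : Euc d} (hx : x ∈ Metric.ball x₀ r)
    (hx0 : graphHeight e γ x = 0) :
    outerNormal Ω x =
      (‖graphNormal e γ (perpProj e x)‖)⁻¹ • graphNormal e γ (perpProj e x) := by
  have hn := h.isOuterUnitNormal hx hx0
  have hex : ∃ n, IsOuterUnitNormal Ω x n := ⟨_, hn⟩
  rw [outerNormal, dif_pos hex]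
  exact hex.choose_spec.eq hn

lemma HasC1Boundary.continuousOn_outerNormal {d : ℕ} {Ω : Set (Euc d)} (hΩ : HasC1Boundary Ω)
    (hΩo : IsOpen Ω) : ContinuousOn (outerNormal Ω) (frontier Ω) := by
  intro x hx
  obtain ⟨r, e, γ, hr, h⟩ := hΩ.exists_isGraphChart hx
  have hm : Continuous fun z => graphNormal e γ (perpProj e z) :=
    (continuous_graphNormal h.contDiff).comp (perpProj e).continuous
  have hc : Continuous fun z => (‖graphNormal e γ (perpProj e z)‖)⁻¹ •
      graphNormal e γ (perpProj e z) :=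
    (hm.norm.inv₀ fun z => norm_ne_zero_iff.2 (graphNormal_ne_zero h.norm_eq_one _)).smul hm
  refine hc.continuousAt.continuousWithinAt.congr_of_eventuallyEq ?_ ?_
  · filter_upwards [self_mem_nhdsWithin,
      mem_nhdsWithin_of_mem_nhds (Metric.ball_mem_nhds x hr)] with z hz hzb
    exact h.outerNormal_eq hzb ((h.mem_frontier_iff hΩo hzb).1 hz)
  · exact h.outerNormal_eq (Metric.mem_ball_self hr)
      ((h.mem_frontier_iff hΩo (Metric.mem_ball_self hr)).1 hx)

/-- At a boundary point the tangent cone of `closure Ω` contains an open half-space, so derivatives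
along `closure Ω` are unique. -/
lemma HasC1Boundary.uniqueDiffOn_closure {d : ℕ} {Ω : Set (Euc d)} (hΩ : HasC1Boundary Ω)
    (hΩo : IsOpen Ω) : UniqueDiffOn ℝ (closure Ω) := by
  intro x hxc
  by_cases hxΩ : x ∈ Ω
  · exact (hΩo.uniqueDiffWithinAt hxΩ).mono subset_closure
  have hx : x ∈ frontier Ω := by rw [hΩo.frontier_eq]; exact ⟨hxc, hxΩ⟩
  obtain ⟨r, e, γ, hr, h⟩ := hΩ.exists_isGraphChart hx
  have hxb := Metric.mem_ball_self hr (x := x)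
  have hx0 := (h.mem_frontier_iff hΩo hxb).1 hx
  refine ⟨?_, subset_closure hxc⟩
  let U : Set (Euc d) := {v | conormal e γ (perpProj e x) v < 0}
  have hU : IsOpen U := isOpen_lt (ContinuousLinearMap.continuous _) continuous_const
  have heU : e ∈ U := by
    show conormal e γ (perpProj e x) e < 0
    rw [conormal_self h.norm_eq_one]; norm_num
  have hsub : U ⊆ tangentConeAt ℝ (closure Ω) x := fun v hv =>
    mem_tangentConeAt_of_add_smul_mem (l := 𝓝[>] (0 : ℝ)) (c := id)
      (tendsto_id.mono_left (nhdsWithin_mono _ fun t (ht : 0 < t) => ht.ne'))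
      ((h.eventually_mem hxb hx0 hv).mono fun t ht => subset_closure ht)
  have htop : Submodule.span ℝ (tangentConeAt ℝ (closure Ω) x) = ⊤ :=
    Submodule.eq_top_of_nonempty_interior' _
      ⟨e, mem_interior.2 ⟨U, hsub.trans Submodule.subset_span, hU, heU⟩⟩
  rw [htop]
  exact dense_univ

/-! ### The divergence theorem above a graph -/

lemma integral_fderiv_apply_eq_zero {E : Type*} [NormedAddCommGroup E] [NormedSpace ℝ E]
    [FiniteDimensional ℝ E] [MeasurableSpace E] [BorelSpace E] {μ : Measure E}
    [μ.IsAddHaarMeasure] {f : E → ℝ} (hf : ContDiff ℝ 1 f) (hfc : HasCompactSupport f) (v : E) :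
    ∫ x, fderiv ℝ f x v ∂μ = 0 := by
  have h1 : Integrable (fun x => fderiv ℝ f x v) μ := by
    refine Continuous.integrable_of_hasCompactSupport ?_ ?_
    · exact (hf.continuous_fderiv one_ne_zero).clm_apply continuous_const
    · exact hfc.fderiv_apply ℝ v
  have h2 : Integrable f μ := hf.continuous.integrable_of_hasCompactSupport hfc
  have := integral_mul_fderiv_eq_neg_fderiv_mul_of_integrable (μ := μ) (f := fun _ : E => (1 : ℝ))
    (g := f) (v := v) (by simp) (by simpa using h1) (by simpa using h2)
    (fun x _ => differentiableAt_const _) (fun x _ => hf.differentiable one_ne_zero x)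
  simpa using this

section Epigraph

variable {d : ℕ} {e : Euc d} {γ : perp e → ℝ} {Y : Euc d → ℝ}

lemma hasFDerivAt_graphPoint (hγ : ContDiff ℝ 1 γ) (s : ℝ) (y : perp e) :
    HasFDerivAt (fun y : perp e => graphPoint e γ (y, s))
      ((perp e).subtypeL + (fderiv ℝ γ y).smulRight e) y := by
  have h1 : HasFDerivAt γ (fderiv ℝ γ y) y := (hγ.differentiable one_ne_zero y).hasFDerivAt
  exact ((perp e).subtypeL.hasFDerivAt).add ((h1.add_const s).smul_const e)

lemma hasDerivAt_graphPoint (s : ℝ) (y : perp e) :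
    HasDerivAt (fun s : ℝ => graphPoint e γ (y, s)) e s := by
  have h := ((((hasDerivAt_id s).const_add (γ y)).smul_const e).const_add (y : Euc d))
  simpa [graphPoint] using h

lemma hasCompactSupport_comp_graphPoint (hY : HasCompactSupport Y)
    (s : ℝ) : HasCompactSupport fun y : perp e => Y (graphPoint e γ (y, s)) := by
  refine HasCompactSupport.intro (hY.isCompact.image (perpProj e).continuous) fun y hy => ?_
  by_contra hne
  exact hy ⟨_, subset_tsupport _ hne, perpProj_graphPoint _⟩

/-- In graph coordinates, horizontal derivatives integrate to zero over each translated graph. -/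
lemma integral_horizontal_eq_zero (he : ‖e‖ = 1) (hγ : ContDiff ℝ 1 γ) (hYc : HasCompactSupport Y)
    (hY : ∀ x, 0 < graphHeight e γ x → ContDiffAt ℝ 1 Y x) {s : ℝ} (hs : 0 < s) (u : perp e) :
    ∫ y : perp e, (fderiv ℝ Y (graphPoint e γ (y, s)) (u : Euc d) +
      fderiv ℝ γ y u * fderiv ℝ Y (graphPoint e γ (y, s)) e) = 0 := by
  have hYs : ∀ y : perp e, ContDiffAt ℝ 1 Y (graphPoint e γ (y, s)) := fun y =>
    hY _ (by rw [graphHeight_graphPoint he]; exact hs)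
  have hC : ContDiff ℝ 1 fun y : perp e => Y (graphPoint e γ (y, s)) := by
    refine contDiff_iff_contDiffAt.2 fun y => ?_
    have h2 : ContDiff ℝ 1 fun y : perp e => graphPoint e γ (y, s) :=
      (contDiff_graphPoint hγ).comp (contDiff_id.prodMk contDiff_const)
    exact (hYs y).comp y h2.contDiffAt
  have h0 := integral_fderiv_apply_eq_zero (μ := (volume : Measure (perp e))) hC
    (hasCompactSupport_comp_graphPoint hYc s) u
  rw [← h0]
  congr 1 with y
  have h1 := ((hYs y).differentiableAt one_ne_zero).hasFDerivAt.comp y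
    (hasFDerivAt_graphPoint hγ s y)
  have h1' : fderiv ℝ (fun y : perp e => Y (graphPoint e γ (y, s))) y = _ := h1.fderiv
  rw [h1']
  simp

/-- The divergence theorem for a compactly supported function on the epigraph of a `C¹` function,
with the boundary integral written in the base variable, against the unnormalised conormal. -/
theorem setIntegral_fderiv_epigraph (he : ‖e‖ = 1) (hγ : ContDiff ℝ 1 γ)
    (hYc : HasCompactSupport Y) (hY : ∀ x, 0 < graphHeight e γ x → ContDiffAt ℝ 1 Y x)
    (hY0 : ContinuousOn Y {x | 0 ≤ graphHeight e γ x})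
    (hYi : IntegrableOn (fderiv ℝ Y) {x | 0 < graphHeight e γ x}) (v : Euc d) :
    ∫ x in {x | 0 < graphHeight e γ x}, fderiv ℝ Y x v =
      ∫ y : perp e, conormal e γ y v * Y (graphPoint e γ (y, 0)) := by
  have hG := measurePreserving_graphPoint he hγ.continuous
  have hGe : MeasurableEmbedding (graphPoint e γ) :=
    (graphHomeomorph he hγ.continuous).measurableEmbedding
  have hpre : graphPoint e γ ⁻¹' {x | 0 < graphHeight e γ x} = univ ×ˢ Ioi (0 : ℝ) := by
    ext p
    simp [graphHeight_graphPoint he]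
  set ν : Measure ℝ := volume.restrict (Ioi 0) with hν
  have hres : ((volume : Measure (perp e)).prod (volume : Measure ℝ)).restrict
      (univ ×ˢ Ioi (0 : ℝ)) = (volume : Measure (perp e)).prod ν := by
    rw [hν, ← Measure.prod_restrict, Measure.restrict_univ]
  set D : perp e × ℝ → (Euc d →L[ℝ] ℝ) := fun p => fderiv ℝ Y (graphPoint e γ p) with hD
  have hDi : Integrable D ((volume : Measure (perp e)).prod ν) := by
    have := (hG.integrableOn_comp_preimage hGe).2 hYi
    rwa [hpre, IntegrableOn, hres] at this
  have hint : ∫ x in {x | 0 < graphHeight e γ x}, fderiv ℝ Y x v =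
      ∫ p, D p v ∂((volume : Measure (perp e)).prod ν) := by
    rw [← hG.setIntegral_preimage_emb hGe, hpre, hres]
  have hDa : ∀ u : Euc d, Integrable (fun p => D p u) ((volume : Measure (perp e)).prod ν) :=
    fun u => hDi.apply_continuousLinearMap u
  set A : perp e × ℝ → ℝ := fun p => D p e with hA
  have hAi : Integrable A ((volume : Measure (perp e)).prod ν) := hDa e
  -- a continuous factor in the base variable is bounded over the projected support of `Y`
  have hmul : ∀ c : perp e → ℝ, Continuous c →
      Integrable (fun p => c p.1 * A p) ((volume : Measure (perp e)).prod ν) := by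
    intro c hc
    obtain ⟨M, hM⟩ := (hYc.isCompact.image (perpProj e).continuous).exists_bound_of_continuousOn
      hc.continuousOn
    refine (hAi.norm.const_mul M).mono'
      ((hc.comp continuous_fst).aestronglyMeasurable.mul hAi.aestronglyMeasurable)
      (Eventually.of_forall fun p => ?_)
    rw [norm_mul]
    by_cases hp : graphPoint e γ p ∈ tsupport Y
    · exact mul_le_mul_of_nonneg_right (hM _ ⟨_, hp, perpProj_graphPoint p⟩) (norm_nonneg _)
    · have : A p = 0 := by
        simp [hA, hD, fderiv_of_notMem_tsupport ℝ hp]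
      simp [this]
  set B : perp e × ℝ → ℝ := fun p =>
    D p ((perpProj e v : perp e) : Euc d) + fderiv ℝ γ p.1 (perpProj e v) * A p with hB
  have hBi : Integrable B ((volume : Measure (perp e)).prod ν) :=
    (hDa _).add (hmul (fun y => fderiv ℝ γ y (perpProj e v))
      ((hγ.continuous_fderiv one_ne_zero).clm_apply continuous_const))
  have hcon : Continuous fun y => conormal e γ y v :=
    (continuous_conormal hγ).clm_apply continuous_const
  have hCi := hmul _ hcon
  -- `B` is the derivative along the graph above `P v`; the rest of `v` is vertical
  have hsplit : ∀ p, D p v = B p - conormal e γ p.1 v * A p := by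
    intro p
    have hv : D p v = D p ((perpProj e v : perp e) : Euc d) + inner ℝ e v * D p e := by
      conv_lhs => rw [← perpProj_add_inner_smul he v]
      rw [map_add, map_smul, smul_eq_mul]
    rw [hv, hB, hA, conormal_apply]
    ring
  have hB0 : ∫ p, B p ∂((volume : Measure (perp e)).prod ν) = 0 := by
    rw [integral_prod_symm _ hBi]
    refine integral_eq_zero_of_ae ?_
    filter_upwards [ae_restrict_mem measurableSet_Ioi] with s hs
    exact integral_horizontal_eq_zero he hγ hYc hY hs (perpProj e v)
  have hA0 : ∀ᵐ y : perp e, ∫ s, A (y, s) ∂ν = -Y (graphPoint e γ (y, 0)) := by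
    filter_upwards [hAi.prod_right_ae] with y hy
    have hcs : HasCompactSupport fun s : ℝ => Y (graphPoint e γ (y, s)) := by
      refine HasCompactSupport.intro (hYc.isCompact.image
        (continuous_graphHeight (e := e) hγ.continuous)) fun s hs => ?_
      by_contra hne
      exact hs ⟨_, subset_tsupport _ hne, graphHeight_graphPoint he _⟩
    have := integral_Ioi_of_hasDerivAt_of_tendsto (a := (0 : ℝ)) (m := 0)
      (f := fun s : ℝ => Y (graphPoint e γ (y, s))) (f' := fun s => A (y, s)) ?_ ?_ hy ?_
    · rw [this, zero_sub]
    · refine ContinuousWithinAt.comp (t := {x | 0 ≤ graphHeight e γ x}) (hY0 _ ?_) ?_ ?_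
      · simp [graphHeight_graphPoint he]
      · exact ((continuous_graphPoint hγ.continuous).comp
          (continuous_const.prodMk continuous_id)).continuousWithinAt
      · intro s hs
        simpa [graphHeight_graphPoint he] using hs
    · intro s hs
      have hYs := (hY (graphPoint e γ (y, s))
        (by rw [graphHeight_graphPoint he]; exact hs)).differentiableAt one_ne_zero
      exact hYs.hasFDerivAt.comp_hasDerivAt s (hasDerivAt_graphPoint s y)
    · exact hcs.is_zero_at_infty.mono_left atTop_le_cocompact
  rw [hint]
  simp_rw [hsplit]
  rw [integral_sub hBi hCi, hB0, zero_sub, integral_prod _ hCi, ← integral_neg]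
  refine integral_congr_ae ?_
  filter_upwards [hA0] with y hy
  rw [integral_const_mul, hy]
  ring

end Epigraph

section Chart

variable {d : ℕ} {Ω : Set (Euc d)} {x₀ : Euc d} {r : ℝ} {e : Euc d} {γ : perp e → ℝ}
  {Y : Euc d → ℝ}

lemma integrableOn_fderiv_of_contDiffOn_closure (hΩo : IsOpen Ω) (hΩb : Bornology.IsBounded Ω)
    (hu : UniqueDiffOn ℝ (closure Ω)) (hY : ContDiffOn ℝ 1 Y (closure Ω)) :
    IntegrableOn (fderiv ℝ Y) Ω := by
  have h1 : IntegrableOn (fderivWithin ℝ Y (closure Ω)) (closure Ω) :=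
    (hY.continuousOn_fderivWithin hu le_rfl).integrableOn_compact hΩb.isCompact_closure
  refine (h1.mono_set subset_closure).congr_fun (fun x hx => ?_) hΩo.measurableSet
  exact fderivWithin_of_mem_nhds (mem_of_superset (hΩo.mem_nhds hx) subset_closure)

lemma hasCompactSupport_of_tsupport_subset_ball (hs : tsupport Y ⊆ Metric.ball x₀ r) :
    HasCompactSupport Y :=
  Metric.isCompact_of_isClosed_isBounded (isClosed_tsupport Y) (Metric.isBounded_ball.subset hs)

lemma IsGraphChart.continuousOn_epigraph (h : IsGraphChart Ω x₀ r e γ)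
    (hY : ContinuousOn Y (closure Ω)) (hs : tsupport Y ⊆ Metric.ball x₀ r) :
    ContinuousOn Y {x | 0 ≤ graphHeight e γ x} := by
  intro x hx
  by_cases hxs : x ∈ tsupport Y
  · have hxb := hs hxs
    refine (hY x ((h.mem_closure_iff hxb).2 hx)).mono_of_mem_nhdsWithin ?_
    filter_upwards [self_mem_nhdsWithin,
      mem_nhdsWithin_of_mem_nhds (Metric.isOpen_ball.mem_nhds hxb)] with z hz hzb
    exact (h.mem_closure_iff hzb).2 hz
  · exact (continuousAt_const.congr
      (notMem_tsupport_iff_eventuallyEq.1 hxs).symm).continuousWithinAt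

/-- The divergence theorem for a function supported in a boundary chart. -/
theorem IsGraphChart.setIntegral_fderiv (h : IsGraphChart Ω x₀ r e γ) (hΩo : IsOpen Ω)
    (hΩb : Bornology.IsBounded Ω) (hu : UniqueDiffOn ℝ (closure Ω))
    (hY : ContDiffOn ℝ 1 Y (closure Ω)) (hs : tsupport Y ⊆ Metric.ball x₀ r) (v : Euc d) :
    ∫ x in Ω, fderiv ℝ Y x v =
      ∫ y : perp e, conormal e γ y v * Y (graphPoint e γ (y, 0)) := by
  have hHm : MeasurableSet {x | 0 < graphHeight e γ x} :=
    (isOpen_lt continuous_const (continuous_graphHeight h.contDiff.continuous)).measurableSet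
  have hind : Ω.indicator (fun x => fderiv ℝ Y x v) =
      {x | 0 < graphHeight e γ x}.indicator (fun x => fderiv ℝ Y x v) := by
    ext x
    by_cases hx : x ∈ tsupport Y
    · have := h.mem_iff x (hs hx)
      by_cases hxΩ : x ∈ Ω
      · simp [hxΩ, this.1 hxΩ]
      · simp [hxΩ, mt this.2 hxΩ]
    · simp [indicator_apply, fderiv_of_notMem_tsupport ℝ hx]
  have hI := integrableOn_fderiv_of_contDiffOn_closure hΩo hΩb hu hY
  rw [← setIntegral_fderiv_epigraph h.norm_eq_one h.contDiff
    (hasCompactSupport_of_tsupport_subset_ball hs)]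
  · rw [← integral_indicator hΩo.measurableSet, ← integral_indicator hHm, hind]
  · intro x hx
    by_cases hxs : x ∈ tsupport Y
    · have hxΩ := (h.mem_iff x (hs hxs)).2 hx
      exact (hY x (subset_closure hxΩ)).contDiffAt
        (mem_of_superset (hΩo.mem_nhds hxΩ) subset_closure)
    · exact contDiffAt_const.congr_of_eventuallyEq (notMem_tsupport_iff_eventuallyEq.1 hxs)
  · exact h.continuousOn_epigraph hY.continuousOn hs
  · refine IntegrableOn.of_forall_sdiff_eq_zero (f := fderiv ℝ Y) hI hHm fun x hx => ?_
    by_contra hne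
    exact hx.2 ((h.mem_iff x (hs (support_fderiv_subset ℝ hne))).2 hx.1)

/-- A function supported inside `Ω` produces no boundary term. -/
lemma setIntegral_fderiv_eq_zero_of_tsupport_subset (hΩo : IsOpen Ω)
    (hΩb : Bornology.IsBounded Ω) (hY : ContDiffOn ℝ 1 Y (closure Ω)) (hs : tsupport Y ⊆ Ω)
    (v : Euc d) : ∫ x in Ω, fderiv ℝ Y x v = 0 := by
  have hC : ContDiff ℝ 1 Y := by
    refine contDiff_iff_contDiffAt.2 fun x => ?_
    by_cases hxs : x ∈ tsupport Y
    · exact (hY x (subset_closure (hs hxs))).contDiffAt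
        (mem_of_superset (hΩo.mem_nhds (hs hxs)) subset_closure)
    · exact contDiffAt_const.congr_of_eventuallyEq (notMem_tsupport_iff_eventuallyEq.1 hxs)
  rw [setIntegral_eq_integral_of_forall_compl_eq_zero fun x hx => by
    rw [fderiv_of_notMem_tsupport ℝ fun h => hx (hs h)]; rfl]
  exact integral_fderiv_apply_eq_zero hC
    (Metric.isCompact_of_isClosed_isBounded (isClosed_tsupport Y) (hΩb.subset hs)) v

end Chart

/-! ### Surface measure in a chart -/

lemma LipschitzOnWith.euclideanHausdorffMeasure_image_le {X Y : Type*} [EMetricSpace X]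
    [EMetricSpace Y] [MeasurableSpace X] [BorelSpace X] [MeasurableSpace Y] [BorelSpace Y]
    {K : NNReal} {f : X → Y} {s : Set X} (h : LipschitzOnWith K f s) (n : ℕ) :
    (μHE[n] : Measure Y) (f '' s) ≤ (K : ℝ≥0∞) ^ n * (μHE[n] : Measure X) s := by
  simp only [Measure.euclideanHausdorffMeasure_def, Measure.smul_apply, ENNReal.smul_def,
    smul_eq_mul]
  have := h.hausdorffMeasure_image_le (d := (n : ℝ)) n.cast_nonneg
  rw [ENNReal.rpow_natCast] at this
  calc _ ≤ _ * ((K : ℝ≥0∞) ^ n * μH[(n : ℝ)] s) := by gcongr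
    _ = _ := by ring

section SurfaceMeasure

variable {d : ℕ} {Ω : Set (Euc d)} {x₀ : Euc d} {r : ℝ} {e : Euc d} {γ : perp e → ℝ}

/-- Lebesgue measure of the base hyperplane, carried to the graph of `γ`. -/
noncomputable def graphMeasure (e : Euc d) (γ : perp e → ℝ) : Measure (Euc d) :=
  (volume : Measure (perp e)).map fun y => graphPoint e γ (y, 0)

lemma measurableEmbedding_graphPoint_zero (hγ : Continuous γ) :
    MeasurableEmbedding fun y : perp e => graphPoint e γ (y, 0) :=
  (Function.LeftInverse.isClosedEmbedding (f := perpProj e) (fun _ => perpProj_graphPoint _)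
    (perpProj e).continuous
    ((continuous_graphPoint hγ).comp (continuous_id.prodMk continuous_const))).measurableEmbedding

lemma integral_graphMeasure (hγ : Continuous γ) (f : Euc d → ℝ) :
    ∫ x, f x ∂(graphMeasure e γ) = ∫ y : perp e, f (graphPoint e γ (y, 0)) :=
  (measurableEmbedding_graphPoint_zero hγ).integral_map f

lemma continuous_graphPoint_zero (hγ : Continuous γ) :
    Continuous fun y : perp e => graphPoint e γ (y, 0) :=
  (continuous_graphPoint hγ).comp (continuous_id.prodMk continuous_const)

lemma euclideanHausdorffMeasure_perp (he : ‖e‖ = 1) :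
    (μHE[d - 1] : Measure (perp e)) = volume := by
  rw [← finrank_perp he]
  exact InnerProductSpace.euclideanHausdorffMeasure_eq_volume

lemma volume_preimage_graphPoint_le (he : ‖e‖ = 1) (A : Set (Euc d)) :
    volume ((fun y : perp e => graphPoint e γ (y, 0)) ⁻¹' A) ≤ (μHE[d - 1] : Measure (Euc d)) A := by
  have hsub : (fun y : perp e => graphPoint e γ (y, 0)) ⁻¹' A ⊆ perpProj e '' A :=
    fun y hy => ⟨_, hy, perpProj_graphPoint _⟩
  have hL : LipschitzOnWith 1 (perpProj e) A :=
    (perp e).lipschitzWith_orthogonalProjectionOnto.lipschitzOnWith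
  calc volume ((fun y : perp e => graphPoint e γ (y, 0)) ⁻¹' A)
      ≤ volume (perpProj e '' A) := measure_mono hsub
    _ = (μHE[d - 1] : Measure (perp e)) (perpProj e '' A) := by
        rw [euclideanHausdorffMeasure_perp he]
    _ ≤ _ := by simpa using hL.euclideanHausdorffMeasure_image_le (d - 1)

namespace IsGraphChart

lemma graphPoint_zero_mem_frontier (h : IsGraphChart Ω x₀ r e γ) (hΩo : IsOpen Ω) {y : perp e}
    (hy : graphPoint e γ (y, 0) ∈ Metric.ball x₀ r) : graphPoint e γ (y, 0) ∈ frontier Ω :=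
  (h.mem_frontier_iff hΩo hy).2 (graphHeight_graphPoint h.norm_eq_one _)

lemma graphPoint_perpProj (h : IsGraphChart Ω x₀ r e γ) (hΩo : IsOpen Ω) {x : Euc d}
    (hx : x ∈ Metric.ball x₀ r) (hxf : x ∈ frontier Ω) :
    graphPoint e γ (perpProj e x, 0) = x := by
  conv_rhs => rw [← graphPoint_perpProj_graphHeight (γ := γ) h.norm_eq_one x,
    (h.mem_frontier_iff hΩo hx).1 hxf]

/-- Projection to the base does not increase Hausdorff measure. -/
theorem graphMeasure_restrict_le (h : IsGraphChart Ω x₀ r e γ) (hΩo : IsOpen Ω) :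
    (graphMeasure e γ).restrict (Metric.ball x₀ r) ≤ surfaceMeasure Ω := by
  have hm := (continuous_graphPoint_zero h.contDiff.continuous).measurable
  refine Measure.le_iff.2 fun A hA => ?_
  rw [Measure.restrict_apply hA, graphMeasure,
    Measure.map_apply hm (hA.inter measurableSet_ball), surfaceMeasure, Measure.restrict_apply hA]
  refine le_trans (measure_mono fun y hy => ?_)
    (volume_preimage_graphPoint_le (γ := γ) h.norm_eq_one _)
  exact ⟨hy.1, h.graphPoint_zero_mem_frontier hΩo hy.2⟩

/-- The graph map is Lipschitz over a bounded set, so it increases Hausdorff measure by a bounded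
factor. -/
theorem exists_surfaceMeasure_restrict_le (h : IsGraphChart Ω x₀ r e γ) (hΩo : IsOpen Ω) :
    ∃ K : NNReal, (surfaceMeasure Ω).restrict (Metric.ball x₀ r) ≤ K • graphMeasure e γ := by
  have hC : ContDiff ℝ 1 fun y : perp e => graphPoint e γ (y, 0) :=
    (contDiff_graphPoint h.contDiff).comp (contDiff_id.prodMk contDiff_const)
  obtain ⟨K, hK⟩ := hC.contDiffOn.exists_lipschitzOnWith one_ne_zero
    (convex_closedBall (perpProj e x₀) r) (isCompact_closedBall (perpProj e x₀) r)
  refine ⟨K ^ (d - 1), Measure.le_iff.2 fun A hA => ?_⟩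
  have hm := (continuous_graphPoint_zero (e := e) h.contDiff.continuous).measurable
  rw [Measure.restrict_apply hA, surfaceMeasure,
    Measure.restrict_apply (hA.inter measurableSet_ball),
    Measure.smul_apply, graphMeasure, Measure.map_apply hm hA]
  let s : Set (perp e) :=
    (fun y : perp e => graphPoint e γ (y, 0)) ⁻¹' A ∩ Metric.closedBall (perpProj e x₀) r
  have hsub : A ∩ Metric.ball x₀ r ∩ frontier Ω ⊆
      (fun y : perp e => graphPoint e γ (y, 0)) '' s := by
    rintro x ⟨⟨hxA, hxb⟩, hxf⟩
    have hx := h.graphPoint_perpProj hΩo hxb hxf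
    refine ⟨perpProj e x, ⟨?_, ?_⟩, hx⟩
    · show graphPoint e γ (perpProj e x, 0) ∈ A
      rwa [hx]
    · have := (perp e).lipschitzWith_orthogonalProjectionOnto.dist_le_mul x x₀
      rw [NNReal.coe_one, one_mul] at this
      exact this.trans (Metric.mem_ball.1 hxb).le
  calc _ ≤ (μHE[d - 1] : Measure (Euc d)) ((fun y : perp e => graphPoint e γ (y, 0)) '' s) :=
        measure_mono hsub
    _ ≤ (K : ℝ≥0∞) ^ (d - 1) * (μHE[d - 1] : Measure (perp e)) s :=
        (hK.mono inter_subset_right).euclideanHausdorffMeasure_image_le (d - 1)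
    _ ≤ _ := by
        rw [euclideanHausdorffMeasure_perp h.norm_eq_one, ENNReal.smul_def, smul_eq_mul,
          ENNReal.coe_pow]
        gcongr
        exact inter_subset_left

lemma graphMeasure_ball_lt_top (h : IsGraphChart Ω x₀ r e γ) :
    graphMeasure e γ (Metric.ball x₀ r) < ⊤ := by
  have hm := (continuous_graphPoint_zero (e := e) h.contDiff.continuous).measurable
  rw [graphMeasure, Measure.map_apply hm measurableSet_ball]
  have hsub : (fun y : perp e => graphPoint e γ (y, 0)) ⁻¹' Metric.ball x₀ r ⊆
      Metric.closedBall (perpProj e x₀) r := by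
    intro y hy
    have hy' : dist (graphPoint e γ (y, 0)) x₀ < r := hy
    have h1 := (perp e).lipschitzWith_orthogonalProjectionOnto.dist_le_mul
      (graphPoint e γ (y, 0)) x₀
    rw [NNReal.coe_one, one_mul] at h1
    have h2 : perpProj e (graphPoint e γ (y, 0)) = y := perpProj_graphPoint _
    rw [Metric.mem_closedBall, ← h2]
    exact h1.trans hy'.le
  exact (measure_mono hsub).trans_lt (isCompact_closedBall (perpProj e x₀) r).measure_lt_top

lemma integrable_graphMeasure (h : IsGraphChart Ω x₀ r e γ) {Y : Euc d → ℝ}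
    (hY : ContinuousOn Y (closure Ω)) (hs : tsupport Y ⊆ Metric.ball x₀ r) :
    Integrable Y (graphMeasure e γ) := by
  refine (measurableEmbedding_graphPoint_zero h.contDiff.continuous).integrable_map_iff.2 ?_
  refine Continuous.integrable_of_hasCompactSupport ?_
    (hasCompactSupport_comp_graphPoint (hasCompactSupport_of_tsupport_subset_ball hs) 0)
  refine (h.continuousOn_epigraph hY hs).comp_continuous
    (continuous_graphPoint_zero h.contDiff.continuous) fun y => ?_
  simp [graphHeight_graphPoint h.norm_eq_one]

/-- The divergence theorem in a boundary chart, with the boundary term an integral over the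
graph. -/
theorem setIntegral_fderiv_eq_integral_graphMeasure (h : IsGraphChart Ω x₀ r e γ)
    (hΩo : IsOpen Ω) (hΩb : Bornology.IsBounded Ω) (hu : UniqueDiffOn ℝ (closure Ω))
    {Y : Euc d → ℝ} (hY : ContDiffOn ℝ 1 Y (closure Ω)) (hs : tsupport Y ⊆ Metric.ball x₀ r)
    (v : Euc d) :
    ∫ x in Ω, fderiv ℝ Y x v = ∫ x, conormal e γ (perpProj e x) v * Y x ∂(graphMeasure e γ) := by
  rw [h.setIntegral_fderiv hΩo hΩb hu hY hs, integral_graphMeasure h.contDiff.continuous]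
  simp_rw [show ∀ y : perp e, perpProj e (graphPoint e γ (y, 0)) = y from
    fun y => perpProj_graphPoint _]

end IsGraphChart

theorem HasC1Boundary.isFiniteMeasure_surfaceMeasure (hΩ : HasC1Boundary Ω) (hΩo : IsOpen Ω)
    (hΩb : Bornology.IsBounded Ω) : IsFiniteMeasure (surfaceMeasure Ω) := by
  have hcomp : IsCompact (frontier Ω) :=
    hΩb.isCompact_closure.of_isClosed_subset isClosed_frontier frontier_subset_closure
  have hfin : surfaceMeasure Ω (frontier Ω) < ⊤ := by
    refine hcomp.measure_lt_top_of_nhdsWithin fun x hx => ?_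
    obtain ⟨r, e, γ, hr, h⟩ := hΩ.exists_isGraphChart hx
    obtain ⟨K, hK⟩ := h.exists_surfaceMeasure_restrict_le hΩo
    refine ⟨Metric.ball x r, mem_nhdsWithin_of_mem_nhds (Metric.ball_mem_nhds x hr), ?_⟩
    have h1 := hK (Metric.ball x r)
    rw [Measure.restrict_apply_self] at h1
    refine h1.trans_lt ?_
    rw [Measure.smul_apply, ENNReal.smul_def, smul_eq_mul]
    exact ENNReal.mul_lt_top ENNReal.coe_lt_top h.graphMeasure_ball_lt_top
  refine ⟨?_⟩
  have : surfaceMeasure Ω univ = surfaceMeasure Ω (frontier Ω) := by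
    rw [surfaceMeasure, Measure.restrict_apply_univ, Measure.restrict_apply_self]
  rwa [this]

theorem HasC1Boundary.surfaceMeasure_univ_pos (hΩ : HasC1Boundary Ω) (hΩo : IsOpen Ω)
    (hne : (frontier Ω).Nonempty) : 0 < surfaceMeasure Ω univ := by
  obtain ⟨x, hx⟩ := hne
  obtain ⟨r, e, γ, hr, h⟩ := hΩ.exists_isGraphChart hx
  have hc := continuous_graphPoint_zero (e := e) h.contDiff.continuous
  have h1 := h.graphMeasure_restrict_le hΩo univ
  refine lt_of_lt_of_le ?_ h1
  rw [Measure.restrict_apply_univ, graphMeasure, Measure.map_apply hc.measurable measurableSet_ball]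
  refine (Metric.isOpen_ball.preimage hc).measure_pos _ ⟨perpProj e x, ?_⟩
  show graphPoint e γ (perpProj e x, 0) ∈ Metric.ball x r
  rw [h.graphPoint_perpProj hΩo (Metric.mem_ball_self hr) hx]
  exact Metric.mem_ball_self hr

end SurfaceMeasure

/-! ### Partition of unity -/

section Partition

variable {d : ℕ} {Ω : Set (Euc d)}

/-- `χ` is a smooth cutoff supported either in `Ω` or in a boundary chart of `Ω`. -/
structure IsLocalCutoff (Ω : Set (Euc d)) (χ : Euc d → ℝ) : Prop where
  contDiff : ContDiff ℝ ∞ χ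
  nonneg : ∀ x, 0 ≤ χ x
  le_one : ∀ x, χ x ≤ 1
  tsupport_subset : tsupport χ ⊆ Ω ∨ ∃ (x₀ : Euc d) (r : ℝ) (e : Euc d) (γ : perp e → ℝ),
    IsGraphChart Ω x₀ r e γ ∧ tsupport χ ⊆ Metric.ball x₀ r

theorem HasC1Boundary.exists_isLocalCutoff_sum_eq_one (hΩ : HasC1Boundary Ω) (hΩo : IsOpen Ω)
    (hΩb : Bornology.IsBounded Ω) :
    ∃ (ι : Type) (_ : Fintype ι) (χ : ι → Euc d → ℝ), (∀ i, IsLocalCutoff Ω (χ i)) ∧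
      ∀ x ∈ closure Ω, ∑ i, χ i x = 1 := by
  choose r e γ hr hch using fun x : frontier Ω => hΩ.exists_isGraphChart x.2
  have hcomp : IsCompact (frontier Ω) :=
    hΩb.isCompact_closure.of_isClosed_subset isClosed_frontier frontier_subset_closure
  obtain ⟨t, ht⟩ := hcomp.elim_finite_subcover (fun x : frontier Ω => Metric.ball (x : Euc d) (r x))
    (fun _ => Metric.isOpen_ball)
    (fun x hx => mem_iUnion.2 ⟨⟨x, hx⟩, Metric.mem_ball_self (hr _)⟩)
  let U : Option t → Set (Euc d) := fun o => o.elim Ω fun x => Metric.ball (x : Euc d) (r x)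
  have hUo : ∀ o, IsOpen (U o) := by
    rintro (_ | x)
    · exact hΩo
    · exact Metric.isOpen_ball
  have hU : closure Ω ⊆ ⋃ o, U o := by
    intro x hx
    by_cases hxΩ : x ∈ Ω
    · exact mem_iUnion.2 ⟨none, hxΩ⟩
    · have hxf : x ∈ frontier Ω := by rw [hΩo.frontier_eq]; exact ⟨hx, hxΩ⟩
      obtain ⟨y, hy, hxy⟩ := mem_iUnion₂.1 (ht hxf)
      exact mem_iUnion.2 ⟨some ⟨y, hy⟩, hxy⟩
  obtain ⟨f, hf⟩ := SmoothPartitionOfUnity.exists_isSubordinate (modelWithCornersSelf ℝ (Euc d))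
    isClosed_closure U hUo hU
  refine ⟨Option t, inferInstance, fun o => f o, fun o => ⟨(f o).contMDiff.contDiff, f.nonneg o,
    f.le_one o, ?_⟩, fun x hx => ?_⟩
  · rcases o with _ | x
    · exact Or.inl (hf none)
    · exact Or.inr ⟨x, r x, e x, γ x, hch x, hf (some x)⟩
  · rw [← f.sum_eq_one hx, finsum_eq_sum_of_fintype]

lemma IsLocalCutoff.mul_contDiffOn {χ : Euc d → ℝ} (hχ : IsLocalCutoff Ω χ) {u : Euc d → ℝ}
    (hu : ContDiffOn ℝ 1 u (closure Ω)) : ContDiffOn ℝ 1 (fun x => χ x * u x) (closure Ω) :=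
  ((hχ.contDiff.of_le (by norm_num)).contDiffOn).mul hu

end Partition

section Integrability

variable {d : ℕ} {Ω : Set (Euc d)} {u : Euc d → ℝ}

lemma ContinuousOn.integrable_surfaceMeasure [IsFiniteMeasure (surfaceMeasure Ω)]
    (hΩb : Bornology.IsBounded Ω) (hu : ContinuousOn u (frontier Ω)) :
    Integrable u (surfaceMeasure Ω) := by
  have hcomp : IsCompact (frontier Ω) :=
    hΩb.isCompact_closure.of_isClosed_subset isClosed_frontier frontier_subset_closure
  have h := hu.integrableOn_compact (μ := surfaceMeasure Ω) hcomp
  rwa [IntegrableOn, surfaceMeasure, Measure.restrict_restrict_of_subset subset_rfl] at h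

lemma ContinuousOn.integrableOn_of_closure (hΩb : Bornology.IsBounded Ω)
    (hu : ContinuousOn u (closure Ω)) : IntegrableOn u Ω :=
  (hu.integrableOn_compact hΩb.isCompact_closure).mono_set subset_closure

lemma ae_mem_frontier_surfaceMeasure : ∀ᵐ x ∂(surfaceMeasure Ω), x ∈ frontier Ω :=
  ae_restrict_mem isClosed_frontier.measurableSet

lemma fderivWithin_closure_eq (hΩo : IsOpen Ω) {x : Euc d} (hx : x ∈ Ω) :
    fderivWithin ℝ u (closure Ω) x = fderiv ℝ u x :=
  fderivWithin_of_mem_nhds (mem_of_superset (hΩo.mem_nhds hx) subset_closure)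

lemma ContDiffOn.contDiffAt_of_mem_open {n : ℕ∞ω} (hΩo : IsOpen Ω)
    (hu : ContDiffOn ℝ n u (closure Ω)) {x : Euc d} (hx : x ∈ Ω) : ContDiffAt ℝ n u x :=
  (hu x (subset_closure hx)).contDiffAt (mem_of_superset (hΩo.mem_nhds hx) subset_closure)

lemma norm_gradient_eq (x : Euc d) : ‖∇ u x‖ = ‖fderiv ℝ u x‖ := by
  rw [gradient, LinearIsometryEquiv.norm_map]

lemma integrableOn_sq_add_norm_gradient_sq (hΩo : IsOpen Ω) (hΩb : Bornology.IsBounded Ω)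
    (hud : UniqueDiffOn ℝ (closure Ω)) (hu : ContDiffOn ℝ 1 u (closure Ω)) :
    IntegrableOn (fun x => u x ^ 2 + ‖∇ u x‖ ^ 2) Ω := by
  have h1 : IntegrableOn (fun x => u x ^ 2 + ‖fderivWithin ℝ u (closure Ω) x‖ ^ 2) Ω :=
    ContinuousOn.integrableOn_of_closure hΩb ((hu.continuousOn.pow 2).add
      ((hu.continuousOn_fderivWithin hud le_rfl).norm.pow 2))
  refine h1.congr_fun (fun x hx => ?_) hΩo.measurableSet
  simp only [norm_gradient_eq, fderivWithin_closure_eq hΩo hx]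

end Integrability

/-! ### The trace inequality -/

section Trace

variable {d : ℕ} {Ω : Set (Euc d)}

lemma IsLocalCutoff.exists_trace_le {χ : Euc d → ℝ} (hχ : IsLocalCutoff Ω χ) (hΩo : IsOpen Ω)
    (hΩb : Bornology.IsBounded Ω) (hud : UniqueDiffOn ℝ (closure Ω)) :
    ∃ C : ℝ, 0 ≤ C ∧ ∀ w : Euc d → ℝ, ContDiffOn ℝ 1 w (closure Ω) →
      ∫ x, χ x * w x ^ 2 ∂(surfaceMeasure Ω) ≤ C * ∫ x in Ω, (w x ^ 2 + ‖∇ w x‖ ^ 2) := by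
  rcases hχ.tsupport_subset with hs | ⟨x₀, r, e, γ, h, hs⟩
  · refine ⟨0, le_rfl, fun w _ => ?_⟩
    rw [zero_mul]
    refine (integral_eq_zero_of_ae ?_).le
    filter_upwards [ae_mem_frontier_surfaceMeasure] with x hx
    have : χ x = 0 := by
      by_contra hne
      have hxΩ := hs (subset_tsupport χ hne)
      rw [hΩo.frontier_eq] at hx
      exact hx.2 hxΩ
    simp [this]
  · obtain ⟨K, hK⟩ := h.exists_surfaceMeasure_restrict_le hΩo
    obtain ⟨M, hM⟩ := hΩb.isCompact_closure.exists_bound_of_continuousOn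
      (hχ.contDiff.continuous_fderiv (by simp)).continuousOn
    refine ⟨K * (|M| + 1), by positivity, fun w hw => ?_⟩
    have hY : ContDiffOn ℝ 1 (fun x => χ x * w x ^ 2) (closure Ω) := hχ.mul_contDiffOn (hw.pow 2)
    have hYs : tsupport (fun x => χ x * w x ^ 2) ⊆ Metric.ball x₀ r :=
      (tsupport_mul_subset_left).trans hs
    have hYi := h.integrable_graphMeasure hY.continuousOn hYs
    have hnn : ∀ x, 0 ≤ χ x * w x ^ 2 := fun x => mul_nonneg (hχ.nonneg x) (sq_nonneg _)
    have h1 : ∫ x, χ x * w x ^ 2 ∂(surfaceMeasure Ω) ≤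
        K * ∫ x, χ x * w x ^ 2 ∂(graphMeasure e γ) := by
      rw [← setIntegral_eq_integral_of_forall_compl_eq_zero (s := Metric.ball x₀ r)
        (μ := surfaceMeasure Ω) fun x hx => image_eq_zero_of_notMem_tsupport fun h => hx (hYs h)]
      refine (integral_mono_measure hK (Eventually.of_forall hnn) hYi.smul_measure_nnreal).trans ?_
      rw [integral_smul_nnreal_measure, NNReal.smul_def, smul_eq_mul]
    have h2 := h.setIntegral_fderiv_eq_integral_graphMeasure hΩo hΩb hud hY hYs e
    simp only [conormal_self h.norm_eq_one, neg_one_mul, integral_neg] at h2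
    have hbound : ∀ x ∈ Ω, -(fderiv ℝ (fun x => χ x * w x ^ 2) x e) ≤
        (|M| + 1) * (w x ^ 2 + ‖∇ w x‖ ^ 2) := by
      intro x hx
      have hwx := (hw.contDiffAt_of_mem_open hΩo hx).differentiableAt one_ne_zero
      have hχx : DifferentiableAt ℝ χ x := hχ.contDiff.differentiable (by simp) x
      have hd : fderiv ℝ (fun x => χ x * w x ^ 2) x e =
          χ x * (2 * w x * fderiv ℝ w x e) + w x ^ 2 * fderiv ℝ χ x e := by
        have := (hχx.hasFDerivAt.mul (hwx.hasFDerivAt.pow 2)).fderiv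
        have h' : fderiv ℝ (fun x => χ x * w x ^ 2) x = _ := this
        rw [h']
        simp
      have b1 : |fderiv ℝ w x e| ≤ ‖∇ w x‖ := by
        have := (fderiv ℝ w x).le_opNorm e
        rwa [h.norm_eq_one, mul_one, ← norm_gradient_eq] at this
      have b2 : |fderiv ℝ χ x e| ≤ |M| := by
        have := (fderiv ℝ χ x).le_opNorm e
        rw [h.norm_eq_one, mul_one] at this
        exact this.trans ((hM x (subset_closure hx)).trans (le_abs_self M))
      have b3 := hχ.nonneg x
      have b4 := hχ.le_one x
      rw [hd]
      have c1 : -(2 * w x * fderiv ℝ w x e) ≤ w x ^ 2 + ‖∇ w x‖ ^ 2 := by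
        have := sq_nonneg (w x + fderiv ℝ w x e)
        have h3 : (fderiv ℝ w x e) ^ 2 ≤ ‖∇ w x‖ ^ 2 := sq_le_sq' (abs_le.1 b1).1 (abs_le.1 b1).2
        nlinarith
      have c2 : χ x * -(2 * w x * fderiv ℝ w x e) ≤ w x ^ 2 + ‖∇ w x‖ ^ 2 := by
        calc _ ≤ χ x * (w x ^ 2 + ‖∇ w x‖ ^ 2) := mul_le_mul_of_nonneg_left c1 b3
          _ ≤ _ := mul_le_of_le_one_left (by positivity) b4
      have c3 : w x ^ 2 * -(fderiv ℝ χ x e) ≤ w x ^ 2 * |M| :=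
        mul_le_mul_of_nonneg_left ((neg_le_abs _).trans b2) (sq_nonneg _)
      have c4 : 0 ≤ |M| * ‖∇ w x‖ ^ 2 := by positivity
      nlinarith
    have h3 : ∫ x, χ x * w x ^ 2 ∂(graphMeasure e γ) ≤
        (|M| + 1) * ∫ x in Ω, (w x ^ 2 + ‖∇ w x‖ ^ 2) := by
      rw [← neg_neg (∫ x, χ x * w x ^ 2 ∂(graphMeasure e γ)), ← h2, ← integral_neg,
        ← integral_const_mul]
      refine setIntegral_mono_on ?_ ?_ hΩo.measurableSet hbound
      · exact ((integrableOn_fderiv_of_contDiffOn_closure hΩo hΩb hud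
          hY).apply_continuousLinearMap e).neg
      · exact (integrableOn_sq_add_norm_gradient_sq hΩo hΩb hud hw).const_mul _
    rw [mul_assoc]
    exact h1.trans (mul_le_mul_of_nonneg_left h3 K.coe_nonneg)

/-- The trace inequality: the `L²` norm on the boundary is controlled by the `H¹` norm. -/
theorem HasC1Boundary.exists_trace_le (hΩ : HasC1Boundary Ω) (hΩo : IsOpen Ω)
    (hΩb : Bornology.IsBounded Ω) :
    ∃ C : ℝ, 0 ≤ C ∧ ∀ w : Euc d → ℝ, ContDiffOn ℝ 1 w (closure Ω) →
      ∫ x, w x ^ 2 ∂(surfaceMeasure Ω) ≤ C * ∫ x in Ω, (w x ^ 2 + ‖∇ w x‖ ^ 2) := by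
  have := hΩ.isFiniteMeasure_surfaceMeasure hΩo hΩb
  obtain ⟨ι, _, χ, hχ, hsum⟩ := hΩ.exists_isLocalCutoff_sum_eq_one hΩo hΩb
  choose C hC0 hC using fun i => (hχ i).exists_trace_le hΩo hΩb (hΩ.uniqueDiffOn_closure hΩo)
  refine ⟨∑ i, C i, Finset.sum_nonneg fun i _ => hC0 i, fun w hw => ?_⟩
  have h1 : ∫ x, w x ^ 2 ∂(surfaceMeasure Ω) =
      ∑ i, ∫ x, χ i x * w x ^ 2 ∂(surfaceMeasure Ω) := by
    rw [← integral_finsetSum]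
    · refine integral_congr_ae ?_
      filter_upwards [ae_mem_frontier_surfaceMeasure] with x hx
      rw [← Finset.sum_mul, hsum x (frontier_subset_closure hx), one_mul]
    · intro i _
      exact ContinuousOn.integrable_surfaceMeasure hΩb
        (((hχ i).mul_contDiffOn (hw.pow 2)).continuousOn.mono frontier_subset_closure)
  rw [h1, Finset.sum_mul]
  exact Finset.sum_le_sum fun i _ => hC i w hw

end Trace

/-! ### Green's inequality -/

section Green

variable {d : ℕ} {Ω : Set (Euc d)}

lemma continuousOn_normalDeriv (hΩ : HasC1Boundary Ω) (hΩo : IsOpen Ω) {u : Euc d → ℝ}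
    (hu : ContDiffOn ℝ 1 u (closure Ω)) : ContinuousOn (normalDeriv Ω u) (frontier Ω) :=
  ((hu.continuousOn_fderivWithin (hΩ.uniqueDiffOn_closure hΩo) le_rfl).mono
    frontier_subset_closure).clm_apply (hΩ.continuousOn_outerNormal hΩo)

/-- The integral over `Ω` of the divergence of `χ w ∇w` is controlled by the boundary integral of
`|w ∂w/∂n|`: the Jacobian of the graph parametrisation is only needed up to a constant. -/
lemma IsLocalCutoff.exists_green_le {χ : Euc d → ℝ} (hχ : IsLocalCutoff Ω χ)
    (hΩ : HasC1Boundary Ω) (hΩo : IsOpen Ω) (hΩb : Bornology.IsBounded Ω) :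
    ∃ C : ℝ, 0 ≤ C ∧ ∀ w : Euc d → ℝ, ContDiffOn ℝ 2 w (closure Ω) →
      ∑ i, ∫ x in Ω, fderiv ℝ (fun x => χ x * (w x * fderivWithin ℝ w (closure Ω) x
          (EuclideanSpace.basisFun (Fin d) ℝ i))) x (EuclideanSpace.basisFun (Fin d) ℝ i) ≤
        C * ∫ x, |w x| * |normalDeriv Ω w x| ∂(surfaceMeasure Ω) := by
  have := hΩ.isFiniteMeasure_surfaceMeasure hΩo hΩb
  have hud := hΩ.uniqueDiffOn_closure hΩo
  set b := EuclideanSpace.basisFun (Fin d) ℝ with hb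
  have hYc : ∀ w : Euc d → ℝ, ContDiffOn ℝ 2 w (closure Ω) → ∀ v : Euc d, ContDiffOn ℝ 1
      (fun x => χ x * (w x * fderivWithin ℝ w (closure Ω) x v)) (closure Ω) := fun w hw v =>
    hχ.mul_contDiffOn ((hw.of_le one_le_two).mul
      ((hw.fderivWithin hud (by norm_num)).clm_apply contDiffOn_const))
  rcases hχ.tsupport_subset with hs | ⟨x₀, r, e, γ, h, hs⟩
  · refine ⟨0, le_rfl, fun w hw => ?_⟩
    rw [zero_mul]
    refine (Finset.sum_eq_zero fun i _ => ?_).le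
    exact setIntegral_fderiv_eq_zero_of_tsupport_subset hΩo hΩb (hYc w hw _)
      (tsupport_mul_subset_left.trans hs) _
  · have hmc : Continuous fun x => graphNormal e γ (perpProj e x) :=
      (continuous_graphNormal h.contDiff).comp (perpProj e).continuous
    obtain ⟨M, hM⟩ := (isCompact_closedBall x₀ r).exists_bound_of_continuousOn hmc.continuousOn
    refine ⟨|M|, abs_nonneg _, fun w hw => ?_⟩
    set L := fderivWithin ℝ w (closure Ω) with hL
    have hYs : ∀ v : Euc d, tsupport (fun x => χ x * (w x * L x v)) ⊆ Metric.ball x₀ r :=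
      fun v => tsupport_mul_subset_left.trans hs
    set F : Euc d → ℝ := fun x => χ x * (w x * L x (graphNormal e γ (perpProj e x))) with hF
    have hFc : ContinuousOn F (closure Ω) :=
      hχ.contDiff.continuous.continuousOn.mul (hw.continuousOn.mul
        ((hw.continuousOn_fderivWithin hud (by norm_num)).clm_apply hmc.continuousOn))
    have hFs : tsupport F ⊆ Metric.ball x₀ r := tsupport_mul_subset_left.trans hs
    have hFi := h.integrable_graphMeasure hFc hFs
    have hsum : ∑ i, ∫ x in Ω, fderiv ℝ (fun x => χ x * (w x * L x (b i))) x (b i) =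
        ∫ x, F x ∂(graphMeasure e γ) := by
      rw [Finset.sum_congr rfl fun i _ => h.setIntegral_fderiv_eq_integral_graphMeasure hΩo hΩb hud
        (hYc w hw (b i)) (hYs (b i)) (b i), ← integral_finsetSum]
      · congr 1 with x
        have hm : graphNormal e γ (perpProj e x) =
            ∑ i, conormal e γ (perpProj e x) (b i) • b i := by
          conv_lhs => rw [← b.sum_repr' (graphNormal e γ (perpProj e x))]
          exact Finset.sum_congr rfl fun i _ => by rw [real_inner_comm, inner_graphNormal]
        simp only [hF]
        rw [hm, map_sum, Finset.mul_sum, Finset.mul_sum]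
        refine Finset.sum_congr rfl fun i _ => ?_
        rw [map_smul, smul_eq_mul]
        ring
      · intro i _
        refine h.integrable_graphMeasure (ContinuousOn.mul ?_ (hYc w hw (b i)).continuousOn)
          (tsupport_mul_subset_right.trans (hYs (b i)))
        exact (((continuous_conormal h.contDiff).comp
          (perpProj e).continuous).clm_apply continuous_const).continuousOn
    have hle := h.graphMeasure_restrict_le hΩo
    have hbi : Integrable (fun x => |M| * (|w x| * |normalDeriv Ω w x|)) (surfaceMeasure Ω) :=
      (ContinuousOn.integrable_surfaceMeasure hΩb
        ((hw.continuousOn.mono frontier_subset_closure).abs.mul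
          (continuousOn_normalDeriv hΩ hΩo (hw.of_le one_le_two)).abs)).const_mul _
    have hpt : ∀ᵐ x ∂(graphMeasure e γ).restrict (Metric.ball x₀ r),
        F x ≤ |M| * (|w x| * |normalDeriv Ω w x|) := by
      filter_upwards [ae_restrict_mem measurableSet_ball,
        ae_mono hle ae_mem_frontier_surfaceMeasure] with x hxb hxf
      have hx0 := (h.mem_frontier_iff hΩo hxb).1 hxf
      have hn : graphNormal e γ (perpProj e x) =
          ‖graphNormal e γ (perpProj e x)‖ • outerNormal Ω x := by
        rw [h.outerNormal_eq hxb hx0, smul_smul, mul_inv_cancel₀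
          (norm_ne_zero_iff.2 (graphNormal_ne_zero h.norm_eq_one _)), one_smul]
      have hFx : F x = χ x * (‖graphNormal e γ (perpProj e x)‖ * (w x * normalDeriv Ω w x)) := by
        simp only [hF]
        conv_lhs => rw [hn]
        rw [map_smul, smul_eq_mul, normalDeriv]
        ring
      have hMx : ‖graphNormal e γ (perpProj e x)‖ ≤ |M| :=
        (hM x (Metric.ball_subset_closedBall hxb)).trans (le_abs_self M)
      calc F x ≤ |F x| := le_abs_self _
        _ = χ x * (‖graphNormal e γ (perpProj e x)‖ * (|w x| * |normalDeriv Ω w x|)) := by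
            rw [hFx, abs_mul, abs_mul, abs_mul, abs_of_nonneg (hχ.nonneg x), abs_norm]
        _ ≤ 1 * (|M| * (|w x| * |normalDeriv Ω w x|)) := by
            have := hχ.le_one x
            gcongr
        _ = _ := one_mul _
    rw [hsum, ← integral_const_mul, ← setIntegral_eq_integral_of_forall_compl_eq_zero
      (s := Metric.ball x₀ r) fun x hx => image_eq_zero_of_notMem_tsupport fun h => hx (hFs h)]
    exact (integral_mono_ae hFi.restrict (hbi.mono_measure hle) hpt).trans
      (integral_mono_measure hle (Eventually.of_forall fun x => by positivity) hbi)

lemma divergence_mul_gradient (hΩo : IsOpen Ω) {w : Euc d → ℝ}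
    (hw : ContDiffOn ℝ 2 w (closure Ω)) {x : Euc d} (hx : x ∈ Ω) :
    ∑ i, fderiv ℝ (fun x => w x * fderivWithin ℝ w (closure Ω) x
        (EuclideanSpace.basisFun (Fin d) ℝ i)) x (EuclideanSpace.basisFun (Fin d) ℝ i) =
      ‖∇ w x‖ ^ 2 + w x * Δ w x := by
  set b := EuclideanSpace.basisFun (Fin d) ℝ with hb
  have hwx := hw.contDiffAt_of_mem_open hΩo hx
  have hd1 : DifferentiableAt ℝ w x := hwx.differentiableAt (by norm_num)
  have hd2 : DifferentiableAt ℝ (fderiv ℝ w) x :=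
    (hwx.fderiv_right (m := 1) (by norm_num)).differentiableAt one_ne_zero
  have hterm : ∀ i, fderiv ℝ (fun x => w x * fderivWithin ℝ w (closure Ω) x (b i)) x (b i) =
      w x * iteratedFDeriv ℝ 2 w x ![b i, b i] + (inner ℝ (b i) (∇ w x)) ^ 2 := by
    intro i
    have hev : (fun x => w x * fderivWithin ℝ w (closure Ω) x (b i)) =ᶠ[𝓝 x]
        fun x => w x * fderiv ℝ w x (b i) := by
      filter_upwards [hΩo.mem_nhds hx] with z hz
      rw [fderivWithin_closure_eq hΩo hz]
    have h2 : HasFDerivAt (fun x => fderiv ℝ w x (b i))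
        ((ContinuousLinearMap.apply ℝ ℝ (b i)).comp (fderiv ℝ (fderiv ℝ w) x)) x :=
      (ContinuousLinearMap.apply ℝ ℝ (b i)).hasFDerivAt.comp x hd2.hasFDerivAt
    have h3 := (hd1.hasFDerivAt.mul h2).fderiv
    have h3' : fderiv ℝ (fun x => w x * fderiv ℝ w x (b i)) x = _ := h3
    have hg : inner ℝ (b i) (∇ w x) = fderiv ℝ w x (b i) := by
      rw [real_inner_comm, gradient, InnerProductSpace.toDual_symm_apply]
    rw [hev.fderiv_eq, h3', hg, iteratedFDeriv_two_apply]
    simp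
    ring
  simp_rw [hterm]
  rw [Finset.sum_add_distrib, ← Finset.mul_sum, b.sum_sq_inner_right,
    InnerProductSpace.laplacian_eq_iteratedFDeriv_orthonormalBasis w b]
  ring

/-- Green's first identity, in the form of an inequality up to a constant of the domain. -/
theorem HasC1Boundary.exists_green_le (hΩ : HasC1Boundary Ω) (hΩo : IsOpen Ω)
    (hΩb : Bornology.IsBounded Ω) :
    ∃ C : ℝ, 0 ≤ C ∧ ∀ w : Euc d → ℝ, ContDiffOn ℝ 2 w (closure Ω) →
      IntegrableOn (fun x => ‖∇ w x‖ ^ 2 + w x * Δ w x) Ω ∧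
      ∫ x in Ω, (‖∇ w x‖ ^ 2 + w x * Δ w x) ≤
        C * ∫ x, |w x| * |normalDeriv Ω w x| ∂(surfaceMeasure Ω) := by
  have hud := hΩ.uniqueDiffOn_closure hΩo
  obtain ⟨ι, _, χ, hχ, hsum⟩ := hΩ.exists_isLocalCutoff_sum_eq_one hΩo hΩb
  choose C hC0 hC using fun i => (hχ i).exists_green_le hΩ hΩo hΩb
  refine ⟨∑ i, C i, Finset.sum_nonneg fun i _ => hC0 i, fun w hw => ?_⟩
  set b := EuclideanSpace.basisFun (Fin d) ℝ with hb
  set Y : Fin d → Euc d → ℝ := fun i x => w x * fderivWithin ℝ w (closure Ω) x (b i) with hY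
  have hYc : ∀ i, ContDiffOn ℝ 1 (Y i) (closure Ω) := fun i =>
    (hw.of_le one_le_two).mul ((hw.fderivWithin hud (by norm_num)).clm_apply contDiffOn_const)
  have hχY : ∀ j i, IntegrableOn (fun x => fderiv ℝ (fun x => χ j x * Y i x) x (b i)) Ω :=
    fun j i => (integrableOn_fderiv_of_contDiffOn_closure hΩo hΩb hud
      ((hχ j).mul_contDiffOn (hYc i))).apply_continuousLinearMap (b i)
  have hYi : ∀ i, IntegrableOn (fun x => fderiv ℝ (Y i) x (b i)) Ω :=
    fun i => (integrableOn_fderiv_of_contDiffOn_closure hΩo hΩb hud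
      (hYc i)).apply_continuousLinearMap (b i)
  have hdiv : ∀ x ∈ Ω, ∑ i, fderiv ℝ (Y i) x (b i) = ‖∇ w x‖ ^ 2 + w x * Δ w x :=
    fun x hx => divergence_mul_gradient hΩo hw hx
  have hint : IntegrableOn (fun x => ∑ i, fderiv ℝ (Y i) x (b i)) Ω :=
    integrable_finsetSum _ fun i _ => hYi i
  refine ⟨hint.congr_fun hdiv hΩo.measurableSet, ?_⟩
  have hpart : ∀ i, ∀ x ∈ Ω, fderiv ℝ (Y i) x (b i) =
      ∑ j, fderiv ℝ (fun x => χ j x * Y i x) x (b i) := by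
    intro i x hx
    have hdx : ∀ j ∈ Finset.univ, DifferentiableAt ℝ (fun x => χ j x * Y i x) x := fun j _ =>
      (((hχ j).mul_contDiffOn (hYc i)).contDiffAt_of_mem_open hΩo hx).differentiableAt one_ne_zero
    have hev : Y i =ᶠ[𝓝 x] fun x => ∑ j, χ j x * Y i x := by
      filter_upwards [hΩo.mem_nhds hx] with z hz
      rw [← Finset.sum_mul, hsum z (subset_closure hz), one_mul]
    rw [hev.fderiv_eq, fderiv_fun_sum hdx, sum_apply]
  calc ∫ x in Ω, (‖∇ w x‖ ^ 2 + w x * Δ w x)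
      = ∫ x in Ω, ∑ i, fderiv ℝ (Y i) x (b i) :=
        (setIntegral_congr_fun hΩo.measurableSet hdiv).symm
    _ = ∑ i, ∫ x in Ω, fderiv ℝ (Y i) x (b i) := integral_finsetSum _ fun i _ => hYi i
    _ = ∑ i, ∑ j, ∫ x in Ω, fderiv ℝ (fun x => χ j x * Y i x) x (b i) := by
        refine Finset.sum_congr rfl fun i _ => ?_
        rw [← integral_finsetSum _ fun j _ => hχY j i]
        exact setIntegral_congr_fun hΩo.measurableSet (hpart i)
    _ = ∑ j, ∑ i, ∫ x in Ω, fderiv ℝ (fun x => χ j x * Y i x) x (b i) := Finset.sum_comm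
    _ ≤ ∑ j, C j * ∫ x, |w x| * |normalDeriv Ω w x| ∂(surfaceMeasure Ω) :=
        Finset.sum_le_sum fun j _ => hC j w hw
    _ = _ := (Finset.sum_mul _ _ _).symm

end Green

/-! ### The energy estimate -/

section Energy

variable {d : ℕ} {Ω : Set (Euc d)}

lemma measurable_laplacian (u : Euc d → ℝ) : Measurable (Δ u) := by
  rw [InnerProductSpace.laplacian_eq_iteratedFDeriv_orthonormalBasis u
    (EuclideanSpace.basisFun (Fin d) ℝ)]
  refine Finset.measurable_fun_sum _ fun i _ => ?_
  simp only [iteratedFDeriv_two_apply]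
  exact (measurable_fderiv_apply_const ℝ (fderiv ℝ u) _).apply_continuousLinearMap _

/-- Stability of the Neumann problem: the `H¹` norm is controlled by the interior and boundary
residuals. The interior residual is tested against `w` itself, and Young's inequality is used with
weights for which the terms in `w` are absorbed. -/
theorem HasC1Boundary.exists_energy_le (hΩ : HasC1Boundary Ω) (hΩo : IsOpen Ω)
    (hΩb : Bornology.IsBounded Ω) :
    ∃ C : ℝ, 0 < C ∧ ∀ (w c : Euc d → ℝ) (σ : ℝ), ContDiffOn ℝ 2 w (closure Ω) → 0 < σ →
      AEStronglyMeasurable c (volume.restrict Ω) → (∀ᵐ x ∂(volume.restrict Ω), σ ≤ c x) →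
      IntegrableOn (fun x => (-(Δ w x) + c x * w x) ^ 2) Ω →
      ∫ x in Ω, (w x ^ 2 + ‖∇ w x‖ ^ 2) ≤ C * (max 1 σ⁻¹) ^ 2 *
        ((∫ x in Ω, (-(Δ w x) + c x * w x) ^ 2) +
          ∫ x, normalDeriv Ω w x ^ 2 ∂(surfaceMeasure Ω)) := by
  have := hΩ.isFiniteMeasure_surfaceMeasure hΩo hΩb
  have hud := hΩ.uniqueDiffOn_closure hΩo
  obtain ⟨T, hT0, hT⟩ := hΩ.exists_trace_le hΩo hΩb
  obtain ⟨K, hK0, hK⟩ := hΩ.exists_green_le hΩo hΩb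
  refine ⟨2 * (1 + K * (K * T + 1)), by positivity, fun w c σ hw hσ hcm hc hFi => ?_⟩
  have hw1 : ContDiffOn ℝ 1 w (closure Ω) := hw.of_le one_le_two
  obtain ⟨hGi, hG⟩ := hK w hw
  have hTw := hT w hw1
  set F : Euc d → ℝ := fun x => -(Δ w x) + c x * w x with hF
  set a : ℝ := ∫ x in Ω, (w x ^ 2 + ‖∇ w x‖ ^ 2) with ha
  set P : ℝ := ∫ x in Ω, F x ^ 2 with hP
  set Q : ℝ := ∫ x, normalDeriv Ω w x ^ 2 ∂(surfaceMeasure Ω) with hQ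
  set m : ℝ := min 1 σ with hm
  have hm0 : 0 < m := lt_min one_pos hσ
  have hai := integrableOn_sq_add_norm_gradient_sq hΩo hΩb hud hw1
  have hwi : IntegrableOn (fun x => w x ^ 2) Ω :=
    ContinuousOn.integrableOn_of_closure hΩb (hw.continuousOn.pow 2)
  have ha0 : 0 ≤ a := integral_nonneg fun x => by positivity
  have hP0 : 0 ≤ P := integral_nonneg fun x => by positivity
  have hQ0 : 0 ≤ Q := integral_nonneg fun x => by positivity
  have hwa : ∫ x in Ω, w x ^ 2 ≤ a :=
    integral_mono hwi hai fun x => le_add_of_nonneg_right (sq_nonneg _)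
  have hwm : AEStronglyMeasurable w (volume.restrict Ω) :=
    (hw.continuousOn.mono subset_closure).aestronglyMeasurable hΩo.measurableSet
  have hFm : AEStronglyMeasurable F (volume.restrict Ω) :=
    (measurable_laplacian w).aestronglyMeasurable.neg.add (hcm.mul hwm)
  have hFwi : IntegrableOn (fun x => F x * w x) Ω := by
    refine (hFi.add hwi).mono' (hFm.mul hwm) (Eventually.of_forall fun x => ?_)
    rw [Real.norm_eq_abs, abs_le, Pi.add_apply]
    constructor <;> nlinarith [sq_nonneg (F x + w x), sq_nonneg (F x - w x)]
  -- the left side of the tested equation: `w Δw + F w = c w²`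
  have hlow : m * a ≤ ∫ x in Ω, ((‖∇ w x‖ ^ 2 + w x * Δ w x) + F x * w x) := by
    rw [ha, ← integral_const_mul]
    refine integral_mono_ae (hai.const_mul m) (hGi.add hFwi) ?_
    filter_upwards [hc] with x hx
    have h1 : m ≤ 1 := min_le_left _ _
    have h2 : m ≤ c x := (min_le_right _ _).trans hx
    have h3 := mul_le_mul_of_nonneg_right h1 (sq_nonneg ‖∇ w x‖)
    have h4 := mul_le_mul_of_nonneg_right h2 (sq_nonneg (w x))
    simp only [hF]
    nlinarith
  have hFw : ∫ x in Ω, F x * w x ≤ m / 4 * a + P / m := by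
    calc ∫ x in Ω, F x * w x ≤ ∫ x in Ω, (m / 4 * w x ^ 2 + m⁻¹ * F x ^ 2) := by
          refine integral_mono hFwi ((hwi.const_mul _).add (hFi.const_mul _)) fun x => ?_
          have h : m / 4 * w x ^ 2 + m⁻¹ * F x ^ 2 - F x * w x =
              m⁻¹ * (m / 2 * w x - F x) ^ 2 := by field_simp; ring
          have : 0 ≤ m⁻¹ * (m / 2 * w x - F x) ^ 2 := by positivity
          show F x * w x ≤ _
          linarith
      _ = m / 4 * (∫ x in Ω, w x ^ 2) + m⁻¹ * P := by
          rw [integral_add (hwi.const_mul _) (hFi.const_mul _), integral_const_mul,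
            integral_const_mul]
      _ ≤ m / 4 * a + P / m := by
          rw [div_eq_inv_mul P]
          gcongr
  have hbi : Integrable (fun x => |w x| * |normalDeriv Ω w x|) (surfaceMeasure Ω) :=
    ContinuousOn.integrable_surfaceMeasure hΩb
      ((hw.continuousOn.mono frontier_subset_closure).abs.mul
        (continuousOn_normalDeriv hΩ hΩo hw1).abs)
  have hbw : Integrable (fun x => w x ^ 2) (surfaceMeasure Ω) :=
    ContinuousOn.integrable_surfaceMeasure hΩb
      ((hw.continuousOn.mono frontier_subset_closure).pow 2)
  have hbn : Integrable (fun x => normalDeriv Ω w x ^ 2) (surfaceMeasure Ω) :=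
    ContinuousOn.integrable_surfaceMeasure hΩb ((continuousOn_normalDeriv hΩ hΩo hw1).pow 2)
  -- the weight `s` is small enough for the trace inequality to absorb the boundary values of `w`
  set s : ℝ := m / (4 * (K * T + 1)) with hs
  have hKT : 0 ≤ K * T := mul_nonneg hK0 hT0
  have hs0 : 0 < s := by positivity
  have hbd : ∫ x, |w x| * |normalDeriv Ω w x| ∂(surfaceMeasure Ω) ≤
      s * (T * a) + s⁻¹ / 4 * Q := by
    calc _ ≤ ∫ x, (s * w x ^ 2 + s⁻¹ / 4 * normalDeriv Ω w x ^ 2) ∂(surfaceMeasure Ω) := by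
          refine integral_mono hbi ((hbw.const_mul _).add (hbn.const_mul _)) fun x => ?_
          have h : s * |w x| ^ 2 + s⁻¹ / 4 * |normalDeriv Ω w x| ^ 2 -
              |w x| * |normalDeriv Ω w x| = s⁻¹ * (s * |w x| - |normalDeriv Ω w x| / 2) ^ 2 := by
            field_simp; ring
          have : 0 ≤ s⁻¹ * (s * |w x| - |normalDeriv Ω w x| / 2) ^ 2 := by positivity
          rw [sq_abs, sq_abs] at h
          show |w x| * |normalDeriv Ω w x| ≤ _
          linarith
      _ = s * (∫ x, w x ^ 2 ∂(surfaceMeasure Ω)) + s⁻¹ / 4 * Q := by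
          rw [integral_add (hbw.const_mul _) (hbn.const_mul _), integral_const_mul,
            integral_const_mul]
      _ ≤ _ := by gcongr
  have hmain : m * a ≤ K * (s * (T * a) + s⁻¹ / 4 * Q) + (m / 4 * a + P / m) := by
    refine hlow.trans ?_
    rw [integral_add hGi hFwi]
    exact add_le_add (hG.trans (mul_le_mul_of_nonneg_left hbd hK0)) hFw
  have habs : K * (s * (T * a)) ≤ m / 4 * a := by
    have h1 : K * (s * (T * a)) = m / 4 * a * (K * T / (K * T + 1)) := by
      rw [hs]; field_simp
    rw [h1]
    exact mul_le_of_le_one_right (by positivity) ((div_le_one (by positivity)).2 (by linarith))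
  have hsinv : K * (s⁻¹ / 4 * Q) = K * (K * T + 1) * Q / m := by
    rw [hs]; field_simp
  have h5 : m / 2 * a ≤ (P + K * (K * T + 1) * Q) / m := by
    rw [add_div, ← hsinv]
    linarith
  have h6 : m ^ 2 * a ≤ 2 * (P + K * (K * T + 1) * Q) := by
    rw [le_div_iff₀ hm0] at h5
    nlinarith
  have hmS : 1 ≤ m * max 1 σ⁻¹ := by
    rcases min_cases 1 σ with ⟨h, -⟩ | ⟨h, -⟩
    · rw [hm, h, one_mul]; exact le_max_left _ _
    · rw [hm, h]
      calc 1 = σ * σ⁻¹ := (mul_inv_cancel₀ hσ.ne').symm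
        _ ≤ _ := mul_le_mul_of_nonneg_left (le_max_right _ _) hσ.le
  set S : ℝ := max 1 σ⁻¹
  have h7 : P + K * (K * T + 1) * Q ≤ (1 + K * (K * T + 1)) * (P + Q) := by
    have : 0 ≤ K * (K * T + 1) * P := by positivity
    nlinarith
  calc a ≤ (m * S) ^ 2 * a := le_mul_of_one_le_left ha0 (one_le_pow₀ hmS)
    _ = S ^ 2 * (m ^ 2 * a) := by ring
    _ ≤ S ^ 2 * (2 * ((1 + K * (K * T + 1)) * (P + Q))) := by
        refine mul_le_mul_of_nonneg_left ?_ (sq_nonneg S)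
        linarith
    _ = _ := by ring

end Energy

/-! ### Bounds from the losses -/

section Loss

variable {d : ℕ} {Ω : Set (Euc d)} {c f g : Euc d → ℝ} {lam δ : ℝ}

lemma integrable_sq_and_integral_le {α : Type*} [MeasurableSpace α] {μ : Measure α} {h : α → ℝ}
    (hm : AEStronglyMeasurable h μ) {A : ℝ} (hA : 0 ≤ A)
    (hle : ∫⁻ x, ENNReal.ofReal (1 * |h x| ^ 2) ∂μ ≤ ENNReal.ofReal A) :
    Integrable (fun x => h x ^ 2) μ ∧ ∫ x, h x ^ 2 ∂μ ≤ A := by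
  simp only [one_mul, sq_abs] at hle
  have hm2 : AEStronglyMeasurable (fun x => h x ^ 2) μ := hm.pow 2
  have hnn : 0 ≤ᵐ[μ] fun x => h x ^ 2 := Eventually.of_forall fun x => sq_nonneg _
  refine ⟨⟨hm2, ?_⟩, ?_⟩
  · rw [hasFiniteIntegral_iff_ofReal hnn]
    exact hle.trans_lt ENNReal.ofReal_lt_top
  · rw [integral_eq_lintegral_of_nonneg_ae hnn hm2]
    exact ENNReal.toReal_le_of_le_ofReal hA hle

lemma basicLoss_bounds (hΩ : HasC1Boundary Ω) (hΩo : IsOpen Ω) (hlam : 0 < lam)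
    (hc : AEStronglyMeasurable c (volume.restrict Ω))
    (hf : AEStronglyMeasurable f (volume.restrict Ω))
    (hg : AEStronglyMeasurable g (surfaceMeasure Ω)) {u : Euc d → ℝ} (hu : u ∈ CkClosure 2 Ω)
    (hJ : basicLoss Ω c f g lam u < ENNReal.ofReal δ) :
    (IntegrableOn (fun x => (-(Δ u x) + c x * u x - f x) ^ 2) Ω ∧
      ∫ x in Ω, (-(Δ u x) + c x * u x - f x) ^ 2 ≤ δ) ∧
    (Integrable (fun x => (normalDeriv Ω u x - g x) ^ 2) (surfaceMeasure Ω) ∧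
      ∫ x, (normalDeriv Ω u x - g x) ^ 2 ∂(surfaceMeasure Ω) ≤ δ / lam) := by
  have hδ : 0 < δ := ENNReal.ofReal_pos.1 (lt_of_le_of_lt zero_le hJ)
  have hu2 : ContDiffOn ℝ 2 u (closure Ω) := hu
  have hum : AEStronglyMeasurable u (volume.restrict Ω) :=
    (hu2.continuousOn.mono subset_closure).aestronglyMeasurable hΩo.measurableSet
  have hnm : AEStronglyMeasurable (normalDeriv Ω u) (surfaceMeasure Ω) :=
    (continuousOn_normalDeriv hΩ hΩo (hu2.of_le one_le_two)).aestronglyMeasurable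
      isClosed_frontier.measurableSet
  rw [basicLoss, weightedResidual] at hJ
  refine ⟨integrable_sq_and_integral_le
    (((measurable_laplacian u).aestronglyMeasurable.neg.add (hc.mul hum)).sub hf) hδ.le
    (le_self_add.trans hJ.le), integrable_sq_and_integral_le (hnm.sub hg) (by positivity) ?_⟩
  rw [ENNReal.ofReal_div_of_pos hlam, ENNReal.le_div_iff_mul_le
    (Or.inl (ENNReal.ofReal_pos.2 hlam).ne') (Or.inl ENNReal.ofReal_ne_top), mul_comm]
  exact le_add_self.trans hJ.le

/-- The constant weights `1` have zero penalty, so the SelectNet loss dominates the basic loss. -/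
lemma basicLoss_le_selectLoss (hΩ : HasC1Boundary Ω) (hΩo : IsOpen Ω)
    (hΩb : Bornology.IsBounded Ω) (hne : Ω.Nonempty) (hfr : (frontier Ω).Nonempty)
    {S' S'' : Set (Euc d → ℝ)} (hS' : IsWeightClass Ω S') (hS'' : IsWeightClass (frontier Ω) S'')
    (ε : ℝ) (u : Euc d → ℝ) :
    ((basicLoss Ω c f g lam u : ℝ≥0∞) : EReal) ≤ selectLoss Ω c f g lam ε S' S'' u := by
  have := hΩ.isFiniteMeasure_surfaceMeasure hΩo hΩb
  obtain ⟨φ', hφ', h1'⟩ := hS'.2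
  obtain ⟨φ'', hφ'', h1''⟩ := hS''.2
  have e1 : ∫⁻ x in Ω, ENNReal.ofReal (φ' x) = volume Ω := by
    rw [setLIntegral_congr_fun hΩo.measurableSet fun x hx => by rw [h1' x hx]]
    simp
  have e2 : ∫⁻ x, ENNReal.ofReal (φ'' x) ∂(surfaceMeasure Ω) = surfaceMeasure Ω univ := by
    rw [lintegral_congr_ae (g := fun _ => 1)
      (ae_mem_frontier_surfaceMeasure.mono fun x hx => by simp [h1'' x hx])]
    simp
  have hpen : selectPenalty Ω φ' φ'' = 0 := by
    have hv0 : volume Ω ≠ 0 := (hΩo.measure_pos volume hne).ne'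
    have hvt : volume Ω ≠ ⊤ := hΩb.measure_lt_top.ne
    have h11 : (1 : EReal) - 1 = 0 :=
      EReal.sub_self (EReal.coe_ne_top 1) (EReal.coe_ne_bot 1)
    rw [selectPenalty, e1, e2, ENNReal.div_self hv0 hvt,
      ENNReal.div_self (hΩ.surfaceMeasure_univ_pos hΩo hfr).ne' (measure_ne_top _ _),
      EReal.coe_ennreal_one, h11]
    simp
  have hres : weightedResidual Ω c f g lam φ' φ'' u = basicLoss Ω c f g lam u := by
    rw [basicLoss, weightedResidual, weightedResidual]
    congr 1
    · exact setLIntegral_congr_fun hΩo.measurableSet fun x hx => by simp only [h1' x hx]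
    · congr 1
      exact lintegral_congr_ae
        (ae_mem_frontier_surfaceMeasure.mono fun x hx => by simp only [h1'' x hx])
  rw [selectLoss]
  refine le_trans ?_ (le_iSup₂_of_le φ' hφ' (le_iSup₂_of_le φ'' hφ'' le_rfl))
  rw [hpen, hres, mul_zero, sub_zero]

lemma normalDeriv_sub (hΩ : HasC1Boundary Ω) (hΩo : IsOpen Ω) {u v : Euc d → ℝ}
    (hu : ContDiffOn ℝ 1 u (closure Ω)) (hv : ContDiffOn ℝ 1 v (closure Ω)) {x : Euc d}
    (hx : x ∈ frontier Ω) :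
    normalDeriv Ω (u - v) x = normalDeriv Ω u x - normalDeriv Ω v x := by
  have hxc := frontier_subset_closure hx
  rw [normalDeriv, fderivWithin_sub (hΩ.uniqueDiffOn_closure hΩo x hxc)
    (hu.differentiableOn one_ne_zero x hxc) (hv.differentiableOn one_ne_zero x hxc)]
  rfl

lemma integral_sq_sub_le {α : Type*} [MeasurableSpace α] {μ : Measure α} {h k : α → ℝ} {A : ℝ}
    (hm : AEStronglyMeasurable (fun x => h x - k x) μ)
    (hh : Integrable (fun x => h x ^ 2) μ ∧ ∫ x, h x ^ 2 ∂μ ≤ A)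
    (hk : Integrable (fun x => k x ^ 2) μ ∧ ∫ x, k x ^ 2 ∂μ ≤ A) :
    Integrable (fun x => (h x - k x) ^ 2) μ ∧ ∫ x, (h x - k x) ^ 2 ∂μ ≤ 4 * A := by
  have hb : ∀ x, (h x - k x) ^ 2 ≤ 2 * h x ^ 2 + 2 * k x ^ 2 := fun x => by
    nlinarith [sq_nonneg (h x + k x)]
  have hi := (hh.1.const_mul 2).add (hk.1.const_mul 2)
  have hint : Integrable (fun x => (h x - k x) ^ 2) μ := by
    refine hi.mono' (hm.pow 2) (Eventually.of_forall fun x => ?_)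
    rw [Real.norm_eq_abs, abs_of_nonneg (sq_nonneg _)]
    exact hb x
  refine ⟨hint, (integral_mono hint hi hb).trans ?_⟩
  simp only [Pi.add_apply]
  rw [integral_add (hh.1.const_mul 2) (hk.1.const_mul 2), integral_const_mul, integral_const_mul]
  linarith [hh.2, hk.2]

end Loss

/-! ### Stability of near-minimisers -/

lemma frontier_nonempty_of_isBounded {d : ℕ} (hd : 1 ≤ d) {Ω : Set (Euc d)}
    (hΩb : Bornology.IsBounded Ω) (hne : Ω.Nonempty) : (frontier Ω).Nonempty := by
  have : Nontrivial (Euc d) := by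
    have : Nonempty (Fin d) := ⟨⟨0, hd⟩⟩
    infer_instance
  refine nonempty_frontier_iff.2 ⟨hne, fun h => ?_⟩
  rw [h] at hΩb
  exact NormedSpace.unbounded_univ ℝ (Euc d) hΩb

lemma h1Norm_le_ofReal {d : ℕ} {Ω : Set (Euc d)} {w : Euc d → ℝ} {X : ℝ} (hX : 0 ≤ X)
    (hi : IntegrableOn (fun x => w x ^ 2 + ‖∇ w x‖ ^ 2) Ω)
    (h : ∫ x in Ω, (w x ^ 2 + ‖∇ w x‖ ^ 2) ≤ X ^ 2) : h1Norm Ω w ≤ ENNReal.ofReal X := by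
  simp only [h1Norm, sq_abs]
  rw [← ofReal_integral_eq_lintegral_ofReal hi (Eventually.of_forall fun x => by positivity)]
  calc _ ≤ (ENNReal.ofReal (X ^ 2)) ^ (1 / 2 : ℝ) := by gcongr
    _ = ENNReal.ofReal X := by
      rw [ENNReal.ofReal_rpow_of_nonneg (sq_nonneg X) (by norm_num), ← Real.sqrt_eq_rpow,
        Real.sqrt_sq hX]

theorem mainTheorem2 {d : ℕ} (hd : 1 ≤ d) (Ω : Set (Euc d)) (hΩo : IsOpen Ω)
    (hΩb : Bornology.IsBounded Ω) (hΩ : HasC1Boundary Ω) :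
    ∃ C : ℝ, 0 < C ∧
      ∀ (c f g : Euc d → ℝ) (σ lam ε δ : ℝ) (N S' S'' : Set (Euc d → ℝ)) (u_b u_s : Euc d → ℝ),
        0 < σ → 0 < lam → 0 < ε →
        MemLp c 2 (volume.restrict Ω) → (∀ᵐ x ∂(volume.restrict Ω), σ ≤ c x) →
        MemLp f 2 (volume.restrict Ω) → MemLp g 2 (surfaceMeasure Ω) →
        HasUniqueNeumannSolution Ω c f g →
        N ⊆ CkClosure 2 Ω →
        IsWeightClass Ω S' → IsWeightClass (frontier Ω) S'' →
        u_b ∈ N → basicLoss Ω c f g lam u_b < ENNReal.ofReal δ →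
        u_s ∈ N → selectLoss Ω c f g lam ε S' S'' u_s < (δ : EReal) →
        h1Norm Ω (u_b - u_s) ≤
          ENNReal.ofReal (C * max 1 σ⁻¹ * max 1 (lam ^ (-(1 / 2) : ℝ)) * δ ^ (1 / 2 : ℝ)) := by
  -- for empty `Ω` the averages in the penalty are `0 / 0`, but the `H¹` norm vanishes
  rcases Ω.eq_empty_or_nonempty with hemp | hne
  · refine ⟨1, one_pos, fun _ _ _ _ _ _ _ _ _ _ _ _ _ _ _ _ _ _ _ _ _ _ _ _ _ _ _ => ?_⟩
    simp [h1Norm, hemp]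
  have hfr := frontier_nonempty_of_isBounded hd hΩb hne
  have hud := hΩ.uniqueDiffOn_closure hΩo
  obtain ⟨C, hC0, hC⟩ := hΩ.exists_energy_le hΩo hΩb
  -- each of the two squared residuals of the difference is at most `4` times the bound for one of
  -- the functions
  refine ⟨√(8 * C), by positivity, ?_⟩
  intro c f g σ lam ε δ N S' S'' u_b u_s hσ hlam _ hcm hcσ hf hg _ hN hS' hS'' hub hJb hus hJs
  have hb2 : ContDiffOn ℝ 2 u_b (closure Ω) := hN hub
  have hs2 : ContDiffOn ℝ 2 u_s (closure Ω) := hN hus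
  have hw2 : ContDiffOn ℝ 2 (u_b - u_s) (closure Ω) := hb2.sub hs2
  have hJs' : basicLoss Ω c f g lam u_s < ENNReal.ofReal δ := by
    have h1 := (basicLoss_le_selectLoss hΩ hΩo hΩb hne hfr hS' hS'' ε u_s).trans_lt hJs
    refine EReal.coe_ennreal_lt_coe_ennreal_iff.1 (h1.trans_le ?_)
    rw [EReal.coe_ennreal_ofReal]
    exact_mod_cast le_max_left δ 0
  have hδ : 0 < δ := ENNReal.ofReal_pos.1 (lt_of_le_of_lt zero_le hJb)
  obtain ⟨hbI, hbB⟩ := basicLoss_bounds hΩ hΩo hlam hcm.1 hf.1 hg.1 (hN hub) hJb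
  obtain ⟨hsI, hsB⟩ := basicLoss_bounds hΩ hΩo hlam hcm.1 hf.1 hg.1 (hN hus) hJs'
  have hum : ∀ u : Euc d → ℝ, ContDiffOn ℝ 2 u (closure Ω) →
      AEStronglyMeasurable (fun x => -(Δ u x) + c x * u x - f x) (volume.restrict Ω) := fun u hu =>
    ((measurable_laplacian u).aestronglyMeasurable.neg.add (hcm.1.mul
      ((hu.continuousOn.mono subset_closure).aestronglyMeasurable hΩo.measurableSet))).sub hf.1
  have hnm : ∀ u : Euc d → ℝ, ContDiffOn ℝ 2 u (closure Ω) →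
      AEStronglyMeasurable (fun x => normalDeriv Ω u x - g x) (surfaceMeasure Ω) := fun u hu =>
    ((continuousOn_normalDeriv hΩ hΩo (hu.of_le one_le_two)).aestronglyMeasurable
      isClosed_frontier.measurableSet).sub hg.1
  have hI := integral_sq_sub_le ((hum u_b hb2).sub (hum u_s hs2)) hbI hsI
  have hB := integral_sq_sub_le ((hnm u_b hb2).sub (hnm u_s hs2)) hbB hsB
  have hIeq : ∀ x ∈ Ω, ((-(Δ u_b x) + c x * u_b x - f x) - (-(Δ u_s x) + c x * u_s x - f x)) ^ 2 =
      (-(Δ (u_b - u_s) x) + c x * (u_b - u_s) x) ^ 2 := by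
    intro x hx
    rw [(hb2.contDiffAt_of_mem_open hΩo hx).laplacian_sub (hs2.contDiffAt_of_mem_open hΩo hx),
      Pi.sub_apply]
    ring
  have hBeq : ∫ x, ((normalDeriv Ω u_b x - g x) - (normalDeriv Ω u_s x - g x)) ^ 2
      ∂(surfaceMeasure Ω) = ∫ x, normalDeriv Ω (u_b - u_s) x ^ 2 ∂(surfaceMeasure Ω) := by
    refine integral_congr_ae (ae_mem_frontier_surfaceMeasure.mono fun x hx => ?_)
    simp only
    rw [normalDeriv_sub hΩ hΩo (hb2.of_le one_le_two) (hs2.of_le one_le_two) hx]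
    ring
  rw [setIntegral_congr_fun hΩo.measurableSet hIeq] at hI
  rw [hBeq] at hB
  have hE := hC (u_b - u_s) c σ hw2 hσ hcm.1 hcσ 
    (IntegrableOn.congr_fun hI.1 hIeq hΩo.measurableSet)
  refine h1Norm_le_ofReal (by positivity)
    (integrableOn_sq_add_norm_gradient_sq hΩo hΩb hud (hw2.of_le one_le_two)) (hE.trans ?_)
  set S : ℝ := max 1 σ⁻¹
  set L : ℝ := max 1 (lam ^ (-(1 / 2) : ℝ)) with hL
  have hL1 : 1 ≤ L ^ 2 := one_le_pow₀ (le_max_left _ _)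
  have hL2 : lam⁻¹ ≤ L ^ 2 := by
    have h1 : (lam ^ (-(1 / 2) : ℝ)) ^ 2 = lam⁻¹ := by
      rw [← Real.rpow_natCast, ← Real.rpow_mul hlam.le]
      norm_num [Real.rpow_neg_one]
    rw [← h1]
    exact pow_le_pow_left₀ (Real.rpow_nonneg hlam.le _) (le_max_right _ _) 2
  have hδ2 : (δ ^ (1 / 2 : ℝ)) ^ 2 = δ := by
    rw [← Real.sqrt_eq_rpow, Real.sq_sqrt hδ.le]
  have hX : (√(8 * C) * S * L * δ ^ (1 / 2 : ℝ)) ^ 2 = C * S ^ 2 * (8 * δ * L ^ 2) := by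
    rw [mul_pow, mul_pow, mul_pow, hδ2, Real.sq_sqrt (by positivity)]
    ring
  rw [hX]
  refine mul_le_mul_of_nonneg_left ?_ (by positivity)
  have h1 : δ ≤ δ * L ^ 2 := le_mul_of_one_le_right hδ.le hL1
  have h2 : δ / lam ≤ δ * L ^ 2 := by
    rw [div_eq_mul_inv]
    exact mul_le_mul_of_nonneg_left hL2 hδ.le
  linarith [hI.2, hB.2]
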